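/- Let $K$ be a (nonarchimedean, non-discrete) local field of characteristic $p>0$, with ring of integers $\mathfrak D$, prime ideal $\mathfrak B$, prime element $\mathfrak p$, and residue field $\mathfrak D/\mathfrak B$ of order $q=p^c$. Let $dx$ be the Haar measure on $K^+$ with $\mathfrak D$ of measure $1$, and let $|\cdot|$ be the absolute value determined by $d(\alpha x)=|\alpha|\,dx$. Let $1=\zeta_0,\zeta_1,\dots,\zeta_{c-1}\in K$ be such that their $\mathbb F_p$-span is a subfield of $K$ with $q$ elements, and let $\chi$ be the (continuous, unitary) character of $K^+$ such that $\chi(\zeta_0\mathfrak p^{-1})=e^{2\pi i/p}$ and $\chi(\zeta_\mu\mathfrak p^{-j})=1$ for all $0\le\mu\le c-1$ and $j\in\mathbb Z$ with $(\mu,j)\neq(0,1)$. For $0\le n<q$ with $n=a_0+a_1p+\dots+a_{c-1}p^{c-1}$, $0\le a_i<p$, put $u(n)=(a_0+a_1\zeta_1+\dots+a_{c-1}\zeta_{c-1})\mathfrak p^{-1}$; for $n=b_0+b_1q+\dots+b_sq^s$, $0\le b_i<q$, put $u(n)=u(b_0)+u(b_1)\mathfrak p^{-1}+\dots+u(b_s)\mathfrak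 p^{-s}$. Write $\chi_m(x)=\chi(u(m)x)$, and let $\hat g$ denote the Fourier transform $\hat g(\xi)=\int_K g(x)\overline{\chi(\xi x)}\,dx$, extended to $L^2(K)$ in the usual way. Let $a,b\in K\setminus\{0\}$ and $g\in L^2(K)$. For $k\in\mathbb N_0=\{0,1,2,\dots\}$ set $$\Delta_0(\xi)=\sum_{m\in\mathbb N_0}\big|\hat g(\xi-bu(m))\big|^2,\qquad \Lambda_k(\xi)=\sum_{m\in\mathbb N_0}\hat g\big(\xi-bu(m)\big)\,\overline{\hat g\big(\xi-bu(m)+a^{-1}u(k)\big)},$$ and $$\alpha_0=\operatorname*{ess\,sup}_{\xi}\Delta_0(\xi),\qquad \gamma=\operatorname*{ess\,inf}_{\xi}\Delta_0(\xi),\qquad \sigma=\operatorname*{ess\,sup}_{\xi}\sum_{k\ge 1}|\Lambda_k(\xi)|.$$ (If $\alpha_0<\infty$, the series $\Lambda_k(\xi)$ converges absolutely for almost every $\xi$.) **Theorem 2.3.** If $\sigma<\gamma\le\alpha_0<\infty$, then the Gabor system $\{\chi_m(bx)\,g(x-u(n)a)\}_{m,n\in\mathbb N_0}$ is a frame for $L^2(K)$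 with bounds $(\gamma-\sigma)/|a|$ and $(\alpha_0+\sigma)/|a|$; that is, $0<(\gamma-\sigma)/|a|$ and, for all $f\in L^2(K)$, $$\frac{\gamma-\sigma}{|a|}\,\|f\|_2^2\;\le\;\sum_{m\in\mathbb N_0}\sum_{n\in\mathbb N_0}\Big|\big\langle f,\;\chi_m(b\,\cdot)\,g(\cdot-u(n)a)\big\rangle\Big|^2\;\le\;\frac{\alpha_0+\sigma}{|a|}\,\|f\|_2^2 .$$ -/

import Mathlib

open MeasureTheory ValuativeRel Filter Topology
open scoped ENNReal NNReal ComplexConjugate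

noncomputable section

namespace LocalFieldGabor

/-- The absolute value `|a|` of a locally compact field: the factor by which multiplication
by `a` scales Haar measure, `d(a x) = |a| dx`, and `|0| = 0`. -/
def modulus {K : Type*} [Field K] [TopologicalSpace K] [IsTopologicalDivisionRing K]
    [LocallyCompactSpace K] (a : K) : ℝ :=
  open Classical in
  if h : a = 0 then 0 else (distribHaarChar K (Units.mk0 a h) : ℝ)

/-- `u(m) = (a₀ + a₁ ζ₁ + ⋯ + a_{c-1} ζ_{c-1}) 𝔭⁻¹` for `0 ≤ m < q = p ^ c`, where
`m = a₀ + a₁ p + ⋯ + a_{c-1} p ^ (c-1)` is the base `p` expansion of `m`. -/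
def uDigit {K : Type*} [Field K] (p c : ℕ) (π : K) (ζ : Fin c → K) (m : ℕ) : K :=
  (∑ i : Fin c, ((m / p ^ (i : ℕ) % p : ℕ) : K) * ζ i) * π⁻¹

/-- `u(n) = u(b₀) + u(b₁) 𝔭⁻¹ + ⋯ + u(b_s) 𝔭⁻ˢ`, where `n = b₀ + b₁ q + ⋯ + b_s q ^ s` is the
base `q = p ^ c` expansion of `n`. The digits of index larger than `n` vanish, and so do the
corresponding summands. -/
def u {K : Type*} [Field K] (p c : ℕ) (π : K) (ζ : Fin c → K) (n : ℕ) : K :=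
  ∑ s ∈ Finset.range (n + 1), uDigit p c π ζ (n / (p ^ c) ^ s % p ^ c) * π⁻¹ ^ s

/-- The objects which are fixed once and for all in a local field `K` of characteristic `p`
whose residue field has `q = p ^ c` elements: a prime element `𝔭`, an `𝔽_p`-basis
`1 = ζ₀, …, ζ_{c-1}` of the subfield `GF(q)` of `K`, and the additive character `χ` given on the
elements `ζ_μ 𝔭⁻ʲ` (which generate a dense subgroup of `K`) by its usual values. -/
structure Coordinates (K : Type*) [Field K] [ValuativeRel K] [TopologicalSpace K]
    [IsNonarchimedeanLocalField K] (p c : ℕ) where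
  /-- the residue field has `q = p ^ c` elements -/
  card_residue : Nat.card 𝓀[K] = p ^ c
  /-- the prime element: an element of maximal absolute value in the prime ideal -/
  π : K
  π_lt_one : valuation K π < 1
  le_π : ∀ x : K, valuation K x < 1 → valuation K x ≤ valuation K π
  /-- the elements `ζ₀, …, ζ_{c-1}` -/
  ζ : Fin c → K
  ζ_zero : ∀ i : Fin c, (i : ℕ) = 0 → ζ i = 1
  /-- in characteristic `p` the additive subgroup generated by the `ζ i` is their `𝔽_p`-span;
  it is a subfield with `q` elements -/
  span_ζ : ∃ F : Subfield K, F.toAddSubgroup = AddSubgroup.closure (Set.range ζ) ∧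
    Nat.card F = p ^ c
  /-- the additive character `χ` -/
  χ : AddChar K Circle
  continuous_χ : Continuous χ
  χ_apply : ∀ (i : Fin c) (j : ℤ), (χ (ζ i * π ^ (-j)) : ℂ) =
    if (i : ℕ) = 0 ∧ j = 1 then Complex.exp (2 * Real.pi * Complex.I / p) else 1

variable {K : Type*} [Field K] [ValuativeRel K] [TopologicalSpace K]
  [IsNonarchimedeanLocalField K] [MeasurableSpace K] {p c : ℕ}

/-- The sequence `u(n)` attached to the chosen coordinates. -/
def Coordinates.u (S : Coordinates K p c) (n : ℕ) : K := LocalFieldGabor.u p c S.π S.ζ n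

/-- `∫ f(x) conj (χ(ξ x)) dx` over the ball `𝔅⁻ʲ = 𝔭⁻ʲ 𝔇`. -/
def truncFourier (S : Coordinates K p c) (μ : Measure K) (f : K → ℂ) (j : ℕ) (ξ : K) : ℂ :=
  ∫ x in {x : K | valuation K x ≤ (valuation K S.π)⁻¹ ^ j}, f x * conj (S.χ (ξ * x) : ℂ) ∂μ

/-- The Fourier transform on `L²(K)`: the limit in `L²`, as `j → ∞`, of the integrals
`∫ f(x) conj (χ(ξ x)) dx` over the balls `𝔅⁻ʲ`. The limit exists for every `f ∈ L²(K)` and is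
determined up to equality almost everywhere. -/
def fourier (S : Coordinates K p c) (μ : Measure K) (f : K → ℂ) : K → ℂ :=
  open Classical in
  if h : ∃ F : K → ℂ, MemLp F 2 μ ∧
      Tendsto (fun j : ℕ => eLpNorm (truncFourier S μ f j - F) 2 μ) atTop (𝓝 0)
  then h.choose else 0

/-- `Δ_k(ξ) = ∑_m |ĝ(ξ - b u(m)) ĝ(ξ - b u(m) + a⁻¹ u(k))|`. -/
def Del (S : Coordinates K p c) (μ : Measure K) (g : K → ℂ) (a b : K) (k : ℕ) (ξ : K) : ℝ≥0∞ :=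
  ∑' m : ℕ, ‖fourier S μ g (ξ - b * S.u m) * fourier S μ g (ξ - b * S.u m + a⁻¹ * S.u k)‖ₑ

/-- `Λ_k(ξ) = ∑_m ĝ(ξ - b u(m)) conj (ĝ(ξ - b u(m) + a⁻¹ u(k)))`. If `Δ₀` is essentially bounded,
the series converges absolutely for almost every `ξ`. -/
def Lam (S : Coordinates K p c) (μ : Measure K) (g : K → ℂ) (a b : K) (k : ℕ) (ξ : K) : ℂ :=
  ∑' m : ℕ, fourier S μ g (ξ - b * S.u m) *
    conj (fourier S μ g (ξ - b * S.u m + a⁻¹ * S.u k))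

/-- `α₀ = ess sup Δ₀`. -/
def alpha0 (S : Coordinates K p c) (μ : Measure K) (g : K → ℂ) (a b : K) : ℝ≥0∞ :=
  essSup (Del S μ g a b 0) μ

/-- `γ = ess inf Δ₀`. -/
def gam (S : Coordinates K p c) (μ : Measure K) (g : K → ℂ) (a b : K) : ℝ≥0∞ :=
  essInf (Del S μ g a b 0) μ

/-- `σ = ess sup_ξ ∑_{k ≥ 1} |Λ_k(ξ)|`. -/
def sig (S : Coordinates K p c) (μ : Measure K) (g : K → ℂ) (a b : K) : ℝ≥0∞ :=
  essSup (fun ξ => ∑' k : ℕ, ‖Lam S μ g a b (k + 1) ξ‖ₑ) μ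

/-- The function `x ↦ χ_m(b x) g(x - u(n) a)`, where `χ_m(y) = χ(u(m) y)`. -/
def gaborFun (S : Coordinates K p c) (g : K → ℂ) (a b : K) (m n : ℕ) (x : K) : ℂ :=
  (S.χ (S.u m * (b * x)) : ℂ) * g (x - S.u n * a)

lemma memLp_gaborFun [BorelSpace K] (S : Coordinates K p c) (μ : Measure K) [μ.IsAddHaarMeasure]
    (g : Lp ℂ 2 μ) (a b : K) (m n : ℕ) : MemLp (gaborFun S g a b m n) 2 μ := by
  have h1 : MemLp (fun x => (g : K → ℂ) (x - S.u n * a)) 2 μ :=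
    (Lp.memLp g).comp_measurePreserving (measurePreserving_sub_right μ (S.u n * a))
  refine h1.of_le ?_ ?_
  · have hc : Continuous fun x : K => (S.χ (S.u m * (b * x)) : ℂ) :=
      continuous_subtype_val.comp (S.continuous_χ.comp (by fun_prop))
    exact hc.aestronglyMeasurable.mul h1.1
  · exact Eventually.of_forall fun x => by
      rw [gaborFun, norm_mul, Circle.norm_coe, one_mul]

/-- The Gabor system `{χ_m(b x) g(x - u(n) a)}`, indexed by `(m, n)`, as a family in `L²(K)`. -/
def gabor [BorelSpace K] (S : Coordinates K p c) (μ : Measure K) [μ.IsAddHaarMeasure]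
    (g : Lp ℂ 2 μ) (a b : K) (i : ℕ × ℕ) : Lp ℂ 2 μ :=
  (memLp_gaborFun S μ g a b i.1 i.2).toLp (gaborFun S g a b i.1 i.2)

/-- The family `e` is a frame with bounds `0 < A ≤ B < ∞`:
`A ‖f‖² ≤ ∑ |⟨f, e_i⟩|² ≤ B ‖f‖²` for all `f`, the series being convergent. -/
def IsFrameWithBounds {ι H : Type*} [NormedAddCommGroup H] [InnerProductSpace ℂ H]
    (e : ι → H) (A B : ℝ) : Prop :=
  0 < A ∧ A ≤ B ∧ ∀ f : H, Summable (fun i => ‖inner ℂ (e i) f‖ ^ 2) ∧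
    A * ‖f‖ ^ 2 ≤ ∑' i, ‖inner ℂ (e i) f‖ ^ 2 ∧ ∑' i, ‖inner ℂ (e i) f‖ ^ 2 ≤ B * ‖f‖ ^ 2

end LocalFieldGabor

end

/-! Write `F` for the Fourier transform of `f`. As the transform is an isometry of L², the Gabor
coefficient at `(m, n)` is, up to a unimodular factor, the integral of `h_m(x) χ(u(n) a x)`, where
`h_m(x) = F(x) conj (ĝ(x - b u(m)))`.

The points `u(n)` form a lattice complementary to `𝔇` in `K`, and `χ` is trivial on `𝔇` and on all
products `u(m) u(n)`. Hence `a⁻¹ 𝔇` is a fundamental domain for the lattice of the `a⁻¹ u(k)`, and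
the characters `χ(u(n) a x)` are periodic for that lattice and orthogonal and complete on `a⁻¹ 𝔇`.
For fixed `m` the coefficients are therefore Fourier coefficients of the periodization of `h_m`.
Parseval followed by unfolding, then summation over `m`, gives `∑ |⟨f, ·⟩|² = |a|⁻¹ ∑_l ∫ F(x) conj
(F(x + a⁻¹ u(l))) conj (Λ_l(x)) dx` (`exists_hasSum_sq_norm_integral`, `exists_hasSum_gabor`).

The term `l = 0` is `∫ |F|² Δ₀`, which lies between `γ ‖f‖²` and `α₀ ‖f‖²`. In the others, `2 |F(x)
F(x + t)| ≤ |F(x)|² + |F(x + t)|²`, and translating the second half replaces `Λ_l` by `Λ_{l'}` with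
`u(l') = -u(l)`. Their total is thus at most `σ ‖f‖²` (`sum_enorm_integral_lam_le`).

The identity is proved for `F` bounded with compact support, so that the `h_m` are in L² and the sum
over `l` is finite. Such `f` are dense (`dense_testSubmodule`), and frame inequalities pass to the
closure (`isFrameWithBounds_of_dense`). Surjectivity of the Fourier transform is never needed. -/

set_option linter.unusedSectionVars false

noncomputable section

namespace LocalFieldGabor

namespace Coordinates

/-! ### Digits, the recursion for `u`, and the values of `χ` -/

section Algebra

variable {K : Type*} [Field K] [ValuativeRel K] [TopologicalSpace K]
  [IsNonarchimedeanLocalField K] {p c : ℕ} (S : Coordinates K p c)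

/-- The subfield of `K` spanned by the `ζ i`; it maps isomorphically onto the residue field. -/
def coeffField : Subfield K := S.span_ζ.choose

lemma coeffField_toAddSubgroup :
    S.coeffField.toAddSubgroup = AddSubgroup.closure (Set.range S.ζ) := S.span_ζ.choose_spec.1

lemma card_coeffField : Nat.card S.coeffField = p ^ c := S.span_ζ.choose_spec.2

lemma one_lt_card (S : Coordinates K p c) : 1 < p ^ c := by
  rw [← S.card_residue]; exact Finite.one_lt_card

instance finite_coeffField : Finite S.coeffField :=
  Nat.finite_of_card_ne_zero (by rw [card_coeffField]; exact (zero_lt_one.trans S.one_lt_card).ne')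

lemma ζ_mem (i : Fin c) : S.ζ i ∈ S.coeffField := by
  have : S.ζ i ∈ S.coeffField.toAddSubgroup := by
    rw [coeffField_toAddSubgroup]; exact AddSubgroup.subset_closure ⟨i, rfl⟩
  exact this

/-- A nonzero element of a finite field is a root of unity, and a linearly ordered value group has
no torsion. -/
lemma val_coeff {z : K} (hz : z ∈ S.coeffField) (h0 : z ≠ 0) : valuation K z = 1 := by
  have hu : IsOfFinOrder (Units.mk0 (⟨z, hz⟩ : S.coeffField) (fun h => h0 (congrArg Subtype.val h))) :=
    isOfFinOrder_of_finite _
  obtain ⟨n, hn, h⟩ := isOfFinOrder_iff_pow_eq_one.1 hu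
  have h2 : z ^ n = 1 := by
    have := congrArg (fun t : (S.coeffField)ˣ => ((t : S.coeffField) : K)) h
    simpa using this
  have h3 : valuation K z ^ n = 1 := by rw [← map_pow, h2, map_one]
  exact (pow_eq_one_iff_of_nonneg zero_le hn.ne').1 h3

lemma val_coeff_le {z : K} (hz : z ∈ S.coeffField) : valuation K z ≤ 1 := by
  rcases eq_or_ne z 0 with rfl | h0
  · simp
  · exact (S.val_coeff hz h0).le

/-- The coefficient field embeds in the residue field, and both have `q` elements. -/
lemma exists_coeff {x : K} (hx : valuation K x ≤ 1) :
    ∃ z ∈ S.coeffField, valuation K (x - z) < 1 := by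
  let i : S.coeffField →+* 𝒪[K] :=
    (S.coeffField.subtype).codRestrict (valuation K).integer (fun z => S.val_coeff_le z.2)
  let r : S.coeffField →+* 𝓀[K] := (IsLocalRing.residue 𝒪[K]).comp i
  have hr : Function.Bijective r := r.injective.bijective_of_nat_card_le
    (by rw [S.card_residue, S.card_coeffField])
  obtain ⟨z, hz⟩ := hr.2 (IsLocalRing.residue 𝒪[K] ⟨x, hx⟩)
  refine ⟨z, z.2, ?_⟩
  have h1 : IsLocalRing.residue 𝒪[K] (⟨x, hx⟩ - i z) = 0 := by
    rw [map_sub, ← hz]; exact sub_self _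
  rw [IsLocalRing.residue_eq_zero_iff, IsLocalRing.mem_maximalIdeal, mem_nonunits_iff,
    Valuation.Integers.isUnit_iff_valuation_eq_one (Valuation.integer.integers _)] at h1
  exact lt_of_le_of_ne ((valuation K).map_sub_le hx (S.val_coeff_le z.2)) h1

lemma π_ne_zero : S.π ≠ 0 := by
  obtain ⟨x, hx0, hx⟩ := Valuation.IsNontrivial.exists_lt_one (v := valuation K)
  intro h
  have := S.le_π x hx
  rw [h, map_zero] at this
  exact hx0 (by simpa using this)

lemma val_π_pos : 0 < valuation K S.π := by
  simpa [zero_lt_iff] using S.π_ne_zero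

lemma exists_le_pow (γ : ValueGroupWithZero K) : ∃ n : ℕ, γ ≤ (valuation K S.π)⁻¹ ^ n :=
  have : MulArchimedean (ValueGroupWithZero K) :=
    ValuativeRel.isRankLeOne_iff_mulArchimedean.1 inferInstance
  MulArchimedean.arch γ ((one_lt_inv₀ S.val_π_pos).2 S.π_lt_one)

lemma val_le_π {x : K} (hx : valuation K x < 1) : valuation K (x * S.π⁻¹) ≤ 1 := by
  rw [map_mul, map_inv₀, mul_inv_le_iff₀ S.val_π_pos, one_mul]
  exact S.le_π x hx

lemma exists_coeff_add {x : K} (hx : valuation K x ≤ 1) :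
    ∃ z ∈ S.coeffField, ∃ y, valuation K y ≤ 1 ∧ x = z + y * S.π := by
  obtain ⟨z, hz, h⟩ := S.exists_coeff hx
  exact ⟨z, hz, _, S.val_le_π h, by field_simp [S.π_ne_zero]; ring⟩

/-- The element of the coefficient field with coordinates the base `p` digits of `m`. -/
def digit (m : ℕ) : K := ∑ i : Fin c, ((m / p ^ (i : ℕ) % p : ℕ) : K) * S.ζ i

lemma digit_zero : S.digit 0 = 0 := by simp [digit]

lemma digit_mem (m : ℕ) : S.digit m ∈ S.coeffField :=
  sum_mem fun i _ => mul_mem (natCast_mem _ _) (S.ζ_mem i)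

lemma u_eq_sum (n N : ℕ) (h : n < N) :
    S.u n = ∑ s ∈ Finset.range N, S.digit (n / (p ^ c) ^ s % p ^ c) * S.π⁻¹ * S.π⁻¹ ^ s := by
  have h1 : S.u n = ∑ s ∈ Finset.range (n + 1),
      S.digit (n / (p ^ c) ^ s % p ^ c) * S.π⁻¹ * S.π⁻¹ ^ s := rfl
  rw [h1]
  refine Finset.sum_subset (Finset.range_subset_range.2 h) fun s _ hs => ?_
  have : n < s := by simpa using hs
  rw [Nat.div_eq_of_lt (this.trans (Nat.lt_pow_self S.one_lt_card))]
  simp [digit_zero]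

/-- Splits off the lowest base `q` digit; the inductions on the index of `u` rest on this. -/
lemma u_rec (n : ℕ) : S.u n = S.π⁻¹ * (S.digit (n % p ^ c) + S.u (n / p ^ c)) := by
  rw [S.u_eq_sum n (n + 1 + 1) (by omega),
    S.u_eq_sum (n / p ^ c) (n + 1) (Nat.lt_succ_of_le (Nat.div_le_self _ _)),
    Finset.sum_range_succ', mul_add, Finset.mul_sum, add_comm]
  congr 1
  · simp [mul_comm]
  · refine Finset.sum_congr rfl fun s _ => ?_
    rw [Nat.div_div_eq_div_mul, pow_succ' (p ^ c), pow_succ]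
    ring

lemma u_zero : S.u 0 = 0 := by
  simp [Coordinates.u, LocalFieldGabor.u, uDigit]

/-- The leading digit dominates in absolute value. That nonzero indices have nonzero digits is
assumed as `hd`, since it depends on characteristic `p`; `digit_injOn` supplies it later. -/
lemma inv_pow_le_val_u (N n : ℕ) (h : (p ^ c) ^ N ≤ n)
    (hd : ∀ m, m < p ^ c → m ≠ 0 → S.digit m ≠ 0) :
    (valuation K S.π)⁻¹ ^ (N + 1) ≤ valuation K (S.u n) := by
  have hq := S.one_lt_card
  have hπ : 1 < (valuation K S.π)⁻¹ := (one_lt_inv₀ S.val_π_pos).2 S.π_lt_one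
  induction n using Nat.strong_induction_on generalizing N with
  | _ n ih =>
    have hn : 0 < n := lt_of_lt_of_le (by positivity) h
    rw [S.u_rec, map_mul, map_inv₀, pow_succ']
    refine mul_le_mul_right ?_ _
    by_cases h0 : n / p ^ c = 0
    · have hlt : n < p ^ c := by
        rcases Nat.div_eq_zero_iff.1 h0 with h' | h' <;> omega
      have hN : N = 0 := by
        by_contra hN
        exact absurd (h.trans_lt hlt) (not_lt.2 (Nat.le_self_pow hN _))
      rw [h0, u_zero, add_zero, Nat.mod_eq_of_lt hlt,
        S.val_coeff (S.digit_mem n) (hd n hlt hn.ne'), hN, pow_zero]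
    · have hdig := S.val_coeff_le (S.digit_mem (n % p ^ c))
      -- A nonzero tail has absolute value above 1, so adding the digit does not change it.
      have key : ∀ M : ℕ, (p ^ c) ^ M ≤ n / p ^ c → (valuation K S.π)⁻¹ ^ (M + 1) ≤
          valuation K (S.digit (n % p ^ c) + S.u (n / p ^ c)) := fun M hM => by
        have h1 := ih (n / p ^ c) (Nat.div_lt_self hn hq) M hM
        rwa [Valuation.map_add_eq_of_lt_right]
        exact hdig.trans_lt (lt_of_lt_of_le (one_lt_pow₀ hπ (by omega)) h1)
      rcases N with _ | M
      · refine le_trans ?_ (key 0 (by simpa using Nat.one_le_iff_ne_zero.2 h0))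
        exact pow_le_pow_right₀ hπ.le (by omega)
      · exact key M ((Nat.le_div_iff_mul_le (by omega)).2 (by rwa [← pow_succ]))

lemma tendsto_integer_mul_pow {d : ℕ → K} (hd : ∀ n, valuation K (d n) ≤ 1) :
    Tendsto (fun n : ℕ => d n * S.π ^ n) atTop (𝓝 0) := by
  rw [(IsValuativeTopology.hasBasis_nhds_zero' K).tendsto_right_iff]
  intro γ hγ
  obtain ⟨N, hN⟩ := S.exists_le_pow γ⁻¹
  filter_upwards [eventually_gt_atTop N] with n hn
  have h1 : γ⁻¹ < (valuation K S.π)⁻¹ ^ n := hN.trans_lt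
    (pow_lt_pow_right₀ ((one_lt_inv₀ S.val_π_pos).2 S.π_lt_one) hn)
  simp only [map_mul, map_pow]
  rw [inv_pow, ← one_mul (_ ^ n)⁻¹, lt_mul_inv_iff₀ (pow_pos S.val_π_pos n),
    inv_mul_lt_iff₀ (zero_lt_iff.2 hγ), mul_one] at h1
  exact (mul_le_of_le_one_left' (hd n)).trans_lt h1

lemma χ_coeff_mul_zpow {z : K} (hz : z ∈ S.coeffField) {j : ℤ} (hj : j ≠ 1) :
    S.χ (z * S.π ^ (-j)) = 1 := by
  have hz' : z ∈ AddSubgroup.closure (Set.range S.ζ) := by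
    rw [← coeffField_toAddSubgroup]; exact hz
  clear hz
  induction hz' using AddSubgroup.closure_induction with
  | mem x hx =>
    obtain ⟨i, rfl⟩ := hx
    have := S.χ_apply i j
    rw [if_neg (by tauto)] at this
    exact Circle.ext this
  | zero => simp
  | add x y _ _ hx hy => rw [add_mul, AddChar.map_add_eq_mul, hx, hy, one_mul]
  | neg x _ hx => rw [neg_mul, AddChar.map_neg_eq_inv, hx, inv_one]

lemma χ_inv_π [hp : Fact p.Prime] : S.χ S.π⁻¹ ≠ 1 := by
  have hc : 0 < c := by
    by_contra h
    have := S.one_lt_card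
    rw [show c = 0 by omega] at this
    simp at this
  have h := S.χ_apply ⟨0, hc⟩ 1
  rw [if_pos (by simp), S.ζ_zero _ rfl, one_mul, zpow_neg_one] at h
  intro h1
  rw [h1, Circle.coe_one] at h
  have h2 := (Complex.isPrimitiveRoot_exp p hp.out.ne_zero).pow_eq_one_iff_dvd 1
  rw [pow_one] at h2
  exact hp.out.one_lt.ne' (Nat.dvd_one.1 (h2.1 h.symm))

/-- Removing the leading digits of `x` one at a time leaves `χ` unchanged, as they sit at exponents
`≥ 0`. The remainder tends to 0, and `χ` is continuous. -/
lemma χ_integer {x : K} (hx : valuation K x ≤ 1) : S.χ x = 1 := by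
  have key : ∀ n : ℕ, ∃ d, valuation K d ≤ 1 ∧ S.χ x = S.χ (d * S.π ^ n) := by
    intro n
    induction n with
    | zero => exact ⟨x, hx, by simp⟩
    | succ n ih =>
      obtain ⟨d, hd, h⟩ := ih
      obtain ⟨z, hz, y, hy, rfl⟩ := S.exists_coeff_add hd
      refine ⟨y, hy, ?_⟩
      rw [h, add_mul, AddChar.map_add_eq_mul]
      have := S.χ_coeff_mul_zpow hz (j := -n) (by omega)
      rw [neg_neg, zpow_natCast] at this
      rw [this, one_mul, pow_succ']; ring_nf
  choose d hd h using key
  have h2 := (S.continuous_χ.tendsto 0).comp (S.tendsto_integer_mul_pow hd)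
  rw [AddChar.map_zero_eq_one] at h2
  refine tendsto_nhds_unique (tendsto_const_nhds (x := S.χ x)) (h2.congr fun n => ?_)
  exact (h n).symm

/-- Every monomial that occurs has exponent at most `-2`, whereas `χ` is nontrivial only at exponent
`-1`. -/
lemma χ_coeff_mul_u {z : K} (hz : z ∈ S.coeffField) (j n : ℕ) :
    S.χ (z * S.π⁻¹ ^ (j + 1) * S.u n) = 1 := by
  have hq := S.one_lt_card
  induction n using Nat.strong_induction_on generalizing j with
  | _ n ih =>
    rcases Nat.eq_zero_or_pos n with rfl | hn
    · simp [u_zero]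
    · rw [S.u_rec, show z * S.π⁻¹ ^ (j + 1) * (S.π⁻¹ * (S.digit (n % p ^ c) + S.u (n / p ^ c))) =
        (z * S.digit (n % p ^ c)) * S.π ^ (-((j + 2 : ℕ) : ℤ)) +
          z * S.π⁻¹ ^ (j + 1 + 1) * S.u (n / p ^ c) by
            rw [zpow_neg, zpow_natCast, ← inv_pow]; ring,
        AddChar.map_add_eq_mul, ih _ (Nat.div_lt_self hn hq),
        S.χ_coeff_mul_zpow (mul_mem hz (S.digit_mem _)) (by omega), one_mul]

lemma χ_u_mul_u (m n : ℕ) : S.χ (S.u m * S.u n) = 1 := by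
  have hq := S.one_lt_card
  have key : ∀ j, S.χ (S.π⁻¹ ^ j * S.u m * S.u n) = 1 := by
    induction m using Nat.strong_induction_on with
    | _ m ih =>
      intro j
      rcases Nat.eq_zero_or_pos m with rfl | hm
      · simp [u_zero]
      · rw [S.u_rec m, show S.π⁻¹ ^ j * (S.π⁻¹ * (S.digit (m % p ^ c) + S.u (m / p ^ c))) * S.u n =
          S.digit (m % p ^ c) * S.π⁻¹ ^ (j + 1) * S.u n +
            S.π⁻¹ ^ (j + 1) * S.u (m / p ^ c) * S.u n by ring,
          AddChar.map_add_eq_mul, ih _ (Nat.div_lt_self hm hq), S.χ_coeff_mul_u (S.digit_mem _),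
          one_mul]
  simpa using key 0

end Algebra

/-! ### The lattice of the `u(n)` and its duality with the ring of integers -/

section CharP

variable {K : Type*} [Field K] [ValuativeRel K] [TopologicalSpace K]
  [IsNonarchimedeanLocalField K] {p c : ℕ} [hp : Fact p.Prime] [CharP K p] (S : Coordinates K p c)

lemma exists_digit {z : K} (hz : z ∈ S.coeffField) : ∃ m < p ^ c, S.digit m = z := by
  have hz' : z ∈ AddSubgroup.closure (Set.range S.ζ) := by
    rw [← coeffField_toAddSubgroup]; exact hz
  have h1 : ∃ a : Fin c → ℤ, z = ∑ i, (a i : K) * S.ζ i := by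
    induction hz' using AddSubgroup.closure_induction with
    | mem x hx =>
      obtain ⟨i, rfl⟩ := hx
      exact ⟨Pi.single i 1, by simp [Pi.single_apply]⟩
    | zero => exact ⟨0, by simp⟩
    | add x y hx hy ihx ihy =>
      have mem : ∀ t, t ∈ AddSubgroup.closure (Set.range S.ζ) → t ∈ S.coeffField := fun t ht => by
        rw [← coeffField_toAddSubgroup] at ht; exact ht
      obtain ⟨a, rfl⟩ := ihx (mem _ hx)
      obtain ⟨b, rfl⟩ := ihy (mem _ hy)
      exact ⟨a + b, by simp [add_mul, Finset.sum_add_distrib]⟩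
    | neg x hx ihx =>
      have mem : ∀ t, t ∈ AddSubgroup.closure (Set.range S.ζ) → t ∈ S.coeffField := fun t ht => by
        rw [← coeffField_toAddSubgroup] at ht; exact ht
      obtain ⟨a, rfl⟩ := ihx (mem _ hx)
      exact ⟨-a, by simp⟩
  obtain ⟨a, rfl⟩ := h1
  have hp0 : (0 : ℤ) < p := by exact_mod_cast hp.out.pos
  let f : Fin c → Fin p := fun i => ⟨(a i % p).toNat, by
    have := Int.emod_lt_of_pos (a i) hp0
    have := Int.emod_nonneg (a i) hp0.ne'
    omega⟩
  -- The integer coefficients matter only modulo `p`; their residues are taken as the base `p`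
  -- digits of the index.
  refine ⟨finFunctionFinEquiv f, Fin.is_lt _, Finset.sum_congr rfl fun i _ => ?_⟩
  rw [← finFunctionFinEquiv_symm_apply_val, Equiv.symm_apply_apply]
  congr 1
  have h2 : (((a i % p).toNat : ℤ) : K) = ((a i : ℤ) : K) := by
    rw [Int.toNat_of_nonneg (Int.emod_nonneg _ hp0.ne')]
    have := congrArg (Int.cast : ℤ → K) (Int.emod_add_mul_ediv (a i) p)
    rwa [Int.cast_add, Int.cast_mul, Int.cast_natCast, CharP.cast_eq_zero K p, zero_mul,
      add_zero] at this
  rw [← h2, Int.cast_natCast]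

lemma digit_injOn : Set.InjOn S.digit (Set.Iio (p ^ c)) := by
  let f : Fin (p ^ c) → S.coeffField := fun m => ⟨S.digit m, S.digit_mem m⟩
  have hs : Function.Surjective f := fun z => by
    obtain ⟨m, hm, h⟩ := S.exists_digit z.2
    exact ⟨⟨m, hm⟩, Subtype.ext h⟩
  have hb := hs.bijective_of_nat_card_le (by rw [card_coeffField, Nat.card_fin])
  intro m hm n hn h
  exact congrArg Fin.val (@hb.1 ⟨m, hm⟩ ⟨n, hn⟩ (Subtype.ext h))

lemma inv_pow_le_val_u_of_le {N n : ℕ} (h : (p ^ c) ^ N ≤ n) :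
    (valuation K S.π)⁻¹ ^ (N + 1) ≤ valuation K (S.u n) := by
  refine S.inv_pow_le_val_u N n h fun m hm h0 hd => h0 ?_
  exact S.digit_injOn hm (zero_lt_one.trans S.one_lt_card) (by rw [hd, digit_zero])

lemma inv_le_val_u {n : ℕ} (h : n ≠ 0) : (valuation K S.π)⁻¹ ≤ valuation K (S.u n) := by
  simpa using S.inv_pow_le_val_u_of_le (N := 0) (n := n) (by simpa using Nat.one_le_iff_ne_zero.2 h)

lemma eq_zero_of_val_u_le {n : ℕ} (h : valuation K (S.u n) ≤ 1) : n = 0 := by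
  by_contra h0
  exact absurd ((S.inv_le_val_u h0).trans h) (not_le.2 ((one_lt_inv₀ S.val_π_pos).2 S.π_lt_one))

/-- Digits add inside the coefficient field without carrying, so the sum can be formed digit by
digit. -/
lemma exists_u_add (m n : ℕ) : ∃ k, S.u k = S.u m + S.u n := by
  have hq := S.one_lt_card
  induction h : m + n using Nat.strong_induction_on generalizing m n with
  | _ N ih =>
    rcases Nat.eq_zero_or_pos N with h0 | h0
    · obtain ⟨rfl, rfl⟩ : m = 0 ∧ n = 0 := by omega
      exact ⟨0, by simp [u_zero]⟩
    · have hlt : m / p ^ c + n / p ^ c < N := by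
        rcases Nat.eq_zero_or_pos m with rfl | hm
        · have := Nat.div_lt_self (n := n) (by omega) hq
          simp only [Nat.zero_div]; omega
        · have := Nat.div_lt_self hm hq
          have := Nat.div_le_self n (p ^ c)
          omega
      obtain ⟨t, ht⟩ := ih _ hlt _ _ rfl
      obtain ⟨r, hr, hr'⟩ := S.exists_digit
        (add_mem (S.digit_mem (m % p ^ c)) (S.digit_mem (n % p ^ c)))
      refine ⟨p ^ c * t + r, ?_⟩
      rw [S.u_rec, Nat.mul_add_mod, Nat.mod_eq_of_lt hr, Nat.mul_add_div (by omega),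
        Nat.div_eq_of_lt hr, add_zero, ht, hr', S.u_rec m, S.u_rec n]
      ring

/-- The image of `u` is an additive subgroup, a lattice complementary to the ring of integers. -/
def lattice : AddSubgroup K where
  carrier := Set.range S.u
  add_mem' := by
    rintro _ _ ⟨m, rfl⟩ ⟨n, rfl⟩
    exact S.exists_u_add m n
  zero_mem' := ⟨0, S.u_zero⟩
  neg_mem' := by
    rintro _ ⟨m, rfl⟩
    -- In characteristic `p`, negation is multiplication by `p - 1`, so closure under addition
    -- suffices.
    have h : ∀ k : ℕ, ∃ n, S.u n = k * S.u m := fun k => by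
      induction k with
      | zero => exact ⟨0, by simp [u_zero]⟩
      | succ k ih =>
        obtain ⟨n, hn⟩ := ih
        obtain ⟨t, ht⟩ := S.exists_u_add n m
        exact ⟨t, by rw [ht, hn]; push_cast; ring⟩
    obtain ⟨n, hn⟩ := h (p - 1)
    refine ⟨n, ?_⟩
    rw [hn, Nat.cast_sub hp.out.one_le, CharP.cast_eq_zero]; simp

lemma u_mem_lattice (n : ℕ) : S.u n ∈ S.lattice := ⟨n, rfl⟩

lemma u_injective : Function.Injective S.u := by
  have hq := S.one_lt_card
  intro m n h
  induction m using Nat.strong_induction_on generalizing n with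
  | _ m ih =>
    rcases Nat.eq_zero_or_pos m with rfl | hm
    · rw [u_zero] at h
      exact (S.eq_zero_of_val_u_le (by simp [← h])).symm
    · rw [S.u_rec m, S.u_rec n] at h
      have h1 := mul_left_cancel₀ (inv_ne_zero S.π_ne_zero) h
      have h2 : S.u (m / p ^ c) - S.u (n / p ^ c) =
          S.digit (n % p ^ c) - S.digit (m % p ^ c) := by linear_combination h1
      -- The difference of the tails is a lattice point that is also integral, hence zero.
      obtain ⟨k, hk⟩ := sub_mem (S.u_mem_lattice (m / p ^ c)) (S.u_mem_lattice (n / p ^ c))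
      have hk0 : k = 0 := S.eq_zero_of_val_u_le (by
        rw [hk, h2]; exact S.val_coeff_le (sub_mem (S.digit_mem _) (S.digit_mem _)))
      rw [hk0, u_zero] at hk
      have h3 : m / p ^ c = n / p ^ c := ih _ (Nat.div_lt_self hm hq) (sub_eq_zero.1 hk.symm)
      have h4 : m % p ^ c = n % p ^ c :=
        S.digit_injOn (Nat.mod_lt _ (by omega)) (Nat.mod_lt _ (by omega))
          (by rw [h3] at h1; exact add_right_cancel h1)
      rw [← Nat.div_add_mod m (p ^ c), ← Nat.div_add_mod n (p ^ c), h3, h4]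

/-- With `eq_zero_of_val_u_le` this makes `𝔇` a fundamental domain for the lattice. Multiplying by
`π` lowers the size of `x`; the digit then uncovered is prepended to the index found by induction.
-/
lemma exists_val_sub_u_le (x : K) : ∃ n, valuation K (x - S.u n) ≤ 1 := by
  have key : ∀ (N : ℕ) (x : K), valuation K x ≤ (valuation K S.π)⁻¹ ^ N →
      ∃ y ∈ S.lattice, valuation K (x - y) ≤ 1 := by
    intro N
    induction N with
    | zero => intro x hx; exact ⟨0, zero_mem _, by simpa using hx⟩
    | succ N ih =>
      intro x hx
      have h1 : valuation K (S.π * x) ≤ (valuation K S.π)⁻¹ ^ N := by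
        rw [map_mul, mul_comm, ← le_mul_inv_iff₀ S.val_π_pos]; rwa [pow_succ] at hx
      obtain ⟨_, ⟨t, rfl⟩, hy⟩ := ih _ h1
      obtain ⟨z, hz, d, hd, h⟩ := S.exists_coeff_add hy
      obtain ⟨r, hr, rfl⟩ := S.exists_digit hz
      refine ⟨S.u (p ^ c * t + r), S.u_mem_lattice _, ?_⟩
      have hq := S.one_lt_card
      rw [S.u_rec, Nat.mul_add_mod, Nat.mod_eq_of_lt hr, Nat.mul_add_div (by omega),
        Nat.div_eq_of_lt hr, add_zero]
      convert hd using 2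
      have := S.π_ne_zero
      field_simp
      linear_combination h
  obtain ⟨N, hN⟩ := S.exists_le_pow (valuation K x)
  obtain ⟨_, ⟨n, rfl⟩, h⟩ := key N x hN
  exact ⟨n, h⟩

/-- For the lattice point `u(n)` nearest to `π⁻¹ x⁻¹`, the product `u(n) x` agrees with `π⁻¹` modulo
`𝔇`, and `χ(π⁻¹) ≠ 1`. -/
lemma exists_χ_u_mul_ne_one {x : K} (hx : valuation K x ≤ 1) (h0 : x ≠ 0) :
    ∃ n, S.χ (S.u n * x) ≠ 1 := by
  obtain ⟨n, hn⟩ := S.exists_val_sub_u_le (S.π⁻¹ * x⁻¹)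
  refine ⟨n, fun h => S.χ_inv_π ?_⟩
  have h1 : valuation K ((S.π⁻¹ * x⁻¹ - S.u n) * x) ≤ 1 := by
    rw [map_mul]; exact mul_le_one' hn hx
  have h2 : S.π⁻¹ = S.u n * x + (S.π⁻¹ * x⁻¹ - S.u n) * x := by
    field_simp; ring
  rw [h2, AddChar.map_add_eq_mul, h, S.χ_integer h1, one_mul]

lemma exists_χ_mul_ne_one {n : ℕ} (h0 : n ≠ 0) :
    ∃ x, valuation K x ≤ 1 ∧ S.χ (S.u n * x) ≠ 1 := by
  have hu : S.u n ≠ 0 := fun h => h0 (S.u_injective (by rw [h, u_zero]))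
  refine ⟨(S.u n)⁻¹ * S.π⁻¹, ?_, ?_⟩
  · rw [map_mul, map_inv₀, map_inv₀, inv_mul_le_iff₀ (by simpa [zero_lt_iff] using hu), mul_one]
    exact S.inv_le_val_u h0
  · rw [mul_inv_cancel_left₀ hu]; exact S.χ_inv_π

end CharP

end Coordinates

/-! ### Fractional ideals -/

section Ball

variable {K : Type*} [Field K] [ValuativeRel K]

/-- The fractional ideal `c⁻¹ 𝔇`. -/
def ball (c : K) : Set K := {x | valuation K (c * x) ≤ 1}

lemma mem_ball {c x : K} : x ∈ ball c ↔ valuation K (c * x) ≤ 1 := Iff.rfl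

lemma zero_mem_ball (c : K) : (0 : K) ∈ ball c := by simp [mem_ball]

lemma add_mem_ball {c x y : K} (hx : x ∈ ball c) (hy : y ∈ ball c) : x + y ∈ ball c := by
  rw [mem_ball, mul_add]; exact (valuation K).map_add_le hx hy

lemma neg_mem_ball {c x : K} (hx : x ∈ ball c) : -x ∈ ball c := by
  rw [mem_ball, mul_neg, Valuation.map_neg]; exact hx

lemma sub_mem_ball {c x y : K} (hx : x ∈ ball c) (hy : y ∈ ball c) : x - y ∈ ball c := by
  rw [sub_eq_add_neg]; exact add_mem_ball hx (neg_mem_ball hy)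

variable [TopologicalSpace K] [IsNonarchimedeanLocalField K]

lemma isCompact_ball {c : K} (hc : c ≠ 0) : IsCompact (ball c) := by
  convert IsNonarchimedeanLocalField.isCompact_closedBall K (valuation K c)⁻¹ using 1
  ext x
  rw [mem_ball, map_mul, mul_comm, ← le_mul_inv_iff₀ (by simpa [zero_lt_iff] using hc), one_mul]
  rfl

lemma isOpen_ball (c : K) : IsOpen (ball c) := by
  have h1 : IsOpen {x : K | valuation K x ≤ 1} := by
    have := Valuation.isOpen_closedBall (R := K) (v := valuation K)
      (r := (valuation K).restrict 1) (by simp)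
    simp_rw [Valuation.restrict_le_iff, map_one] at this
    exact this
  exact h1.preimage (continuous_const_mul c)

variable [MeasurableSpace K] [BorelSpace K]

lemma measurableSet_ball (c : K) : MeasurableSet (ball c) := (isOpen_ball c).measurableSet

end Ball

namespace Coordinates

/-! ### Exhaustion by balls and countability properties -/

section Topology

variable {K : Type*} [Field K] [ValuativeRel K] [TopologicalSpace K]
  [IsNonarchimedeanLocalField K] {p c : ℕ} (S : Coordinates K p c)

lemma mem_ball_pow {x : K} {j : ℕ} :
    x ∈ ball (S.π ^ j) ↔ valuation K x ≤ (valuation K S.π)⁻¹ ^ j := by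
  rw [mem_ball, map_mul, map_pow, mul_comm, ← le_mul_inv_iff₀ (pow_pos S.val_π_pos j), one_mul,
    inv_pow]

lemma ball_pow_eq (j : ℕ) :
    ball (S.π ^ j) = {x : K | valuation K x ≤ (valuation K S.π)⁻¹ ^ j} :=
  Set.ext fun _ => S.mem_ball_pow

lemma monotone_ball_pow : Monotone fun j : ℕ => ball (S.π ^ j) := by
  intro i j hij x hx
  rw [mem_ball_pow] at *
  exact hx.trans (pow_le_pow_right₀ ((one_lt_inv₀ S.val_π_pos).2 S.π_lt_one).le hij)

lemma exists_mem_ball_pow (x : K) : ∃ j : ℕ, x ∈ ball (S.π ^ j) := by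
  obtain ⟨j, hj⟩ := S.exists_le_pow (valuation K x)
  exact ⟨j, S.mem_ball_pow.2 hj⟩

lemma iUnion_ball_pow : ⋃ j : ℕ, ball (S.π ^ j) = Set.univ :=
  Set.eq_univ_of_forall fun x => Set.mem_iUnion.2 (S.exists_mem_ball_pow x)

lemma exists_ball_subset {c : K} (hc : c ≠ 0) : ∃ j : ℕ, ball c ⊆ ball (S.π ^ j) := by
  obtain ⟨j, hj⟩ := S.exists_mem_ball_pow c⁻¹
  refine ⟨j, fun x hx => ?_⟩
  rw [mem_ball] at *
  have : S.π ^ j * x = S.π ^ j * c⁻¹ * (c * x) := by field_simp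
  rw [this, map_mul]
  exact mul_le_one' hj hx

lemma sigmaCompactSpace (S : Coordinates K p c) : SigmaCompactSpace K :=
  ⟨⟨fun j : ℕ => ball (S.π ^ j), fun _ => isCompact_ball (pow_ne_zero _ S.π_ne_zero),
    S.iUnion_ball_pow⟩⟩

/-- Leads to pseudometrizability, and from there to regularity of Haar measure and second
countability of `K`. -/
lemma isCountablyGenerated_nhds_zero (S : Coordinates K p c) : (𝓝 (0 : K)).IsCountablyGenerated := by
  have : (𝓝 (0 : K)).HasBasis (fun _ : ℕ => True) fun n => ball (S.π⁻¹ ^ n) := by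
    refine ⟨fun t => ⟨fun ht => ?_, fun ⟨n, _, h⟩ => ?_⟩⟩
    · obtain ⟨γ, hγ, h⟩ := (IsValuativeTopology.hasBasis_nhds_zero' K).mem_iff.1 ht
      obtain ⟨N, hN⟩ := S.exists_le_pow γ⁻¹
      refine ⟨N + 1, trivial, fun x hx => h ?_⟩
      have hx' : valuation K x ≤ valuation K S.π ^ (N + 1) := by
        rwa [mem_ball, map_mul, map_pow, map_inv₀, inv_pow,
          inv_mul_le_iff₀ (pow_pos S.val_π_pos _), mul_one] at hx
      refine hx'.trans_lt ?_
      rw [inv_pow, inv_le_inv₀ (zero_lt_iff.2 hγ) (pow_pos S.val_π_pos _)] at hN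
      refine lt_of_lt_of_le ?_ hN
      exact pow_lt_pow_right_of_lt_one₀ S.val_π_pos S.π_lt_one (Nat.lt_succ_self _)
    · exact mem_of_superset ((isOpen_ball _).mem_nhds (zero_mem_ball _)) h
  exact this.isCountablyGenerated

lemma pseudoMetrizableSpace (S : Coordinates K p c) : TopologicalSpace.PseudoMetrizableSpace K := by
  let := IsTopologicalAddGroup.rightUniformSpace K
  have := isUniformAddGroup_of_addCommGroup (G := K)
  have := S.isCountablyGenerated_nhds_zero
  have := IsUniformAddGroup.uniformity_countably_generated (α := K)
  infer_instance

lemma secondCountableTopology (S : Coordinates K p c) : SecondCountableTopology K := by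
  have := S.pseudoMetrizableSpace
  have := S.sigmaCompactSpace
  let := TopologicalSpace.pseudoMetrizableSpacePseudoMetric K
  exact EMetric.secondCountable_of_sigmaCompact K

end Topology

/-! ### Volumes of balls and the tiling of `K` by translates of a ball -/

section Measure

variable {K : Type*} [Field K] [ValuativeRel K] [TopologicalSpace K]
  [IsNonarchimedeanLocalField K] [MeasurableSpace K] [BorelSpace K]
  {p c : ℕ} (S : Coordinates K p c) (μ : Measure K) [μ.IsAddHaarMeasure]

lemma regular (S : Coordinates K p c) : μ.Regular := by
  have := S.pseudoMetrizableSpace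
  have := S.sigmaCompactSpace
  let := TopologicalSpace.pseudoMetrizableSpacePseudoMetric K
  infer_instance

variable (K) in
lemma _root_.LocalFieldGabor.modulus_pos {a : K} (ha : a ≠ 0) : 0 < modulus a := by
  rw [modulus, dif_neg ha]; exact_mod_cast distribHaarChar_pos

variable {μ}

open Pointwise in
-- Multiplication by `a` carries `a⁻¹ 𝔇` onto `𝔇`.
lemma modulus_mul_measure_ball (S : Coordinates K p c) (hμ : μ {x : K | valuation K x ≤ 1} = 1)
    {a : K} (ha : a ≠ 0) : ENNReal.ofReal (modulus a) * μ (ball a) = 1 := by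
  have := S.regular μ
  rw [modulus, dif_neg ha, ENNReal.ofReal_coe_nnreal, distribHaarChar_mul, ← hμ]
  congr 1
  ext x
  rw [Set.mem_smul_set_iff_inv_smul_mem]
  simp [Units.smul_def, mem_ball, ha]

lemma measure_ball (S : Coordinates K p c) (hμ : μ {x : K | valuation K x ≤ 1} = 1)
    {a : K} (ha : a ≠ 0) : μ (ball a) = ENNReal.ofReal (modulus a)⁻¹ := by
  rw [ENNReal.ofReal_inv_of_pos (modulus_pos K ha)]
  exact ENNReal.eq_inv_of_mul_eq_one_left
    (by rw [mul_comm]; exact S.modulus_mul_measure_ball hμ ha)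

lemma measure_ball_mul_measure_ball_inv (S : Coordinates K p c)
    (hμ : μ {x : K | valuation K x ≤ 1} = 1) {a : K} (ha : a ≠ 0) :
    μ (ball a) * μ (ball a⁻¹) = 1 := by
  have h1 : modulus a * modulus a⁻¹ = 1 := by
    rw [modulus, modulus, dif_neg ha, dif_neg (inv_ne_zero ha)]
    have h : Units.mk0 a⁻¹ (inv_ne_zero ha) = (Units.mk0 a ha)⁻¹ := by ext; simp
    rw [h, map_inv]
    have := (distribHaarChar_pos (A := K) (g := Units.mk0 a ha)).ne'
    push_cast
    exact mul_inv_cancel₀ (by exact_mod_cast this)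
  rw [S.measure_ball hμ ha, S.measure_ball hμ (inv_ne_zero ha),
    ← ENNReal.ofReal_mul (inv_nonneg.2 (modulus_pos K ha).le), ← mul_inv, h1]
  simp

lemma measure_ball_ne_top {a : K} (ha : a ≠ 0) : μ (ball a) ≠ ∞ :=
  (isCompact_ball ha).measure_lt_top.ne

variable [Fact p.Prime] [CharP K p]

/-- The translate `a⁻¹ u(n) + a⁻¹ 𝔇`. -/
def tile (a : K) (n : ℕ) : Set K := {x | x - a⁻¹ * S.u n ∈ ball a}

lemma measurableSet_tile (a : K) (n : ℕ) : MeasurableSet (S.tile a n) :=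
  ((isOpen_ball a).preimage (by fun_prop : Continuous fun x => x - a⁻¹ * S.u n)).measurableSet

lemma exists_mem_tile {a : K} (ha : a ≠ 0) (x : K) : ∃ n, x ∈ S.tile a n := by
  obtain ⟨n, hn⟩ := S.exists_val_sub_u_le (a * x)
  refine ⟨n, ?_⟩
  simpa [tile, mem_ball, mul_sub, mul_inv_cancel_left₀ ha] using hn

lemma iUnion_tile {a : K} (ha : a ≠ 0) : ⋃ n, S.tile a n = Set.univ :=
  Set.eq_univ_of_forall fun x => Set.mem_iUnion.2 (S.exists_mem_tile ha x)

lemma eq_of_u_sub_u_le {m n : ℕ} (h : valuation K (S.u m - S.u n) ≤ 1) : m = n := by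
  obtain ⟨k, hk⟩ := sub_mem (S.u_mem_lattice m) (S.u_mem_lattice n)
  rw [← hk] at h
  rw [S.eq_zero_of_val_u_le h, u_zero] at hk
  exact S.u_injective (sub_eq_zero.1 hk.symm)

lemma pairwise_disjoint_tile {a : K} (ha : a ≠ 0) :
    Pairwise (Function.onFun Disjoint (S.tile a)) := by
  intro m n hmn
  refine Set.disjoint_left.2 fun x hm hn => hmn (S.eq_of_u_sub_u_le ?_)
  have := sub_mem_ball hn hm
  rwa [mem_ball, show a * (x - a⁻¹ * S.u n - (x - a⁻¹ * S.u m)) = S.u m - S.u n by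
    field_simp; ring] at this

lemma preimage_tile (a : K) (n : ℕ) : (fun x => x + a⁻¹ * S.u n) ⁻¹' S.tile a n = ball a := by
  ext x; simp [tile]

variable (μ) in
lemma lintegral_eq_tsum {a : K} (ha : a ≠ 0) (f : K → ℝ≥0∞) :
    ∫⁻ x, f x ∂μ = ∑' n, ∫⁻ x in ball a, f (x + a⁻¹ * S.u n) ∂μ := by
  rw [← setLIntegral_univ, ← S.iUnion_tile ha,
    lintegral_iUnion (S.measurableSet_tile a) (S.pairwise_disjoint_tile ha)]
  congr 1
  ext n
  rw [← (measurePreserving_add_right μ (a⁻¹ * S.u n)).setLIntegral_comp_preimage_emb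
    (measurableEmbedding_addRight _), preimage_tile]

lemma hasSum_setIntegral_ball {a : K} (ha : a ≠ 0) {f : K → ℂ} (hf : Integrable f μ) :
    HasSum (fun n => ∫ x in ball a, f (x + a⁻¹ * S.u n) ∂μ) (∫ x, f x ∂μ) := by
  have h := hasSum_integral_iUnion (S.measurableSet_tile a) (S.pairwise_disjoint_tile ha)
    (f := f) (μ := μ) hf.integrableOn
  rw [S.iUnion_tile ha, setIntegral_univ] at h
  have e : (fun n => ∫ x in ball a, f (x + a⁻¹ * S.u n) ∂μ) =
      fun n => ∫ x in S.tile a n, f x ∂μ := funext fun n => by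
    rw [← (measurePreserving_add_right μ (a⁻¹ * S.u n)).setIntegral_preimage_emb
      (measurableEmbedding_addRight _) f (S.tile a n), preimage_tile]
  rw [e]
  exact h

end Measure

/-! ### Fourier series on a fractional ideal -/

section Parseval

variable {K : Type*} [Field K] [ValuativeRel K] [TopologicalSpace K]
  [IsNonarchimedeanLocalField K] {p c : ℕ} (S : Coordinates K p c)

lemma continuous_χ_mul (t : K) : Continuous fun x : K => (S.χ (t * x) : ℂ) :=
  continuous_subtype_val.comp (S.continuous_χ.comp (continuous_const_mul t))

lemma conj_χ (x : K) : conj (S.χ x : ℂ) = S.χ (-x) := by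
  rw [AddChar.map_neg_eq_inv, Circle.coe_inv_eq_conj]

lemma χ_add (x y : K) : (S.χ (x + y) : ℂ) = S.χ x * S.χ y := by
  rw [AddChar.map_add_eq_mul, Circle.coe_mul]

/-- The character `x ↦ χ(u(n) a x)` of the fractional ideal `a⁻¹ 𝔇`. -/
def ballChar (a : K) (n : ℕ) : C(ball a, ℂ) where
  toFun x := S.χ (S.u n * (a * x))
  continuous_toFun := by
    have := (S.continuous_χ_mul (S.u n * a)).comp (continuous_subtype_val (p := (· ∈ ball a)))
    simpa [mul_assoc, Function.comp_def] using this

lemma ballChar_apply (a : K) (n : ℕ) (x : ball a) :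
    S.ballChar a n x = S.χ (S.u n * (a * x)) := rfl

variable [Fact p.Prime] [CharP K p]

/-- The star subalgebra of `C(a⁻¹ 𝔇, ℂ)` generated by the characters `ballChar a n`. -/
def ballCharSubalgebra (a : K) : StarSubalgebra ℂ C(ball a, ℂ) where
  toSubalgebra := Algebra.adjoin ℂ (Set.range (S.ballChar a))
  star_mem' := by
    change Algebra.adjoin ℂ (Set.range (S.ballChar a)) ≤
      star (Algebra.adjoin ℂ (Set.range (S.ballChar a)))
    refine Algebra.adjoin_le ?_
    rintro - ⟨n, rfl⟩
    obtain ⟨m, hm⟩ := neg_mem (S.u_mem_lattice n)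
    refine Algebra.subset_adjoin ⟨m, ContinuousMap.ext fun x => ?_⟩
    rw [ContinuousMap.star_apply, ballChar_apply, ballChar_apply, hm, neg_mul]
    exact (S.conj_χ _).symm

lemma ballCharSubalgebra_coe (a : K) :
    Subalgebra.toSubmodule (S.ballCharSubalgebra a).toSubalgebra =
      Submodule.span ℂ (Set.range (S.ballChar a)) := by
  apply Algebra.adjoin_eq_span_of_subset
  refine Set.Subset.trans ?_ Submodule.subset_span
  intro x hx
  refine Submonoid.closure_induction (fun _ => id) ⟨0, ?_⟩ ?_ hx
  · ext1 z; simp [ballChar_apply, u_zero]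
  · rintro - - - - ⟨m, rfl⟩ ⟨n, rfl⟩
    obtain ⟨k, hk⟩ := S.exists_u_add m n
    refine ⟨k, ?_⟩
    ext1 z
    rw [ContinuousMap.mul_apply, ballChar_apply, ballChar_apply, ballChar_apply, hk, add_mul,
      χ_add]

lemma ballCharSubalgebra_separatesPoints {a : K} (ha : a ≠ 0) :
    (S.ballCharSubalgebra a).SeparatesPoints := by
  intro x y hxy
  have h0 : a * ((x : K) - y) ≠ 0 := mul_ne_zero ha (sub_ne_zero.2 (Subtype.coe_injective.ne hxy))
  obtain ⟨n, hn⟩ := S.exists_χ_u_mul_ne_one (sub_mem_ball x.2 y.2) h0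
  refine ⟨_, ⟨S.ballChar a n, Algebra.subset_adjoin ⟨n, rfl⟩, rfl⟩, fun h => hn ?_⟩
  simp only [ballChar_apply] at h
  have h' : S.χ (S.u n * (a * x)) = S.χ (S.u n * (a * y)) := Circle.ext h
  rw [mul_sub, mul_sub, sub_eq_add_neg, AddChar.map_add_eq_mul, AddChar.map_neg_eq_inv, h',
    mul_inv_cancel]

/-- Stone–Weierstrass: the span of the characters is a star subalgebra because the lattice is a
group. -/
lemma span_ballChar_closure_eq_top {a : K} (ha : a ≠ 0) :
    (Submodule.span ℂ (Set.range (S.ballChar a))).topologicalClosure = ⊤ := by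
  have : CompactSpace (ball a) := isCompact_iff_compactSpace.1 (isCompact_ball ha)
  rw [← ballCharSubalgebra_coe]
  exact congr_arg (Subalgebra.toSubmodule <| StarSubalgebra.toSubalgebra ·)
    (ContinuousMap.starSubalgebra_topologicalClosure_eq_top_of_separatesPoints _
      (S.ballCharSubalgebra_separatesPoints ha))

variable [MeasurableSpace K] [BorelSpace K] {μ : Measure K} [μ.IsAddHaarMeasure]

lemma setIntegral_ball_add {a t : K} (ht : t ∈ ball a) (f : K → ℂ) :
    ∫ x in ball a, f (x + t) ∂μ = ∫ x in ball a, f x ∂μ := by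
  rw [← (measurePreserving_add_right μ t).setIntegral_preimage_emb
      (measurableEmbedding_addRight _) f (ball a)]
  congr 2
  ext x
  exact ⟨fun h => add_mem_ball h ht, fun h => by simpa using sub_mem_ball h ht⟩

/-- Translation by a suitable point of the ball multiplies the integral by a number other than 1. -/
lemma setIntegral_χ_eq_zero {a : K} (ha : a ≠ 0) {n : ℕ} (hn : n ≠ 0) :
    ∫ x in ball a, (S.χ (S.u n * (a * x)) : ℂ) ∂μ = 0 := by
  obtain ⟨y, hy, h⟩ := S.exists_χ_mul_ne_one hn
  have ht : a⁻¹ * y ∈ ball a := by rwa [mem_ball, mul_inv_cancel_left₀ ha]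
  have h1 := setIntegral_ball_add (μ := μ) ht fun x => (S.χ (S.u n * (a * x)) : ℂ)
  simp_rw [mul_add, mul_inv_cancel_left₀ ha, χ_add, integral_mul_const] at h1
  have h2 : (S.χ (S.u n * y) : ℂ) ≠ 1 := fun h' => h (Circle.ext h')
  by_contra h3
  exact h2 (mul_left_cancel₀ h3 (h1.trans (mul_one _).symm))

/-- Parseval's formula on the compact group `a⁻¹ 𝔇`, whose dual group consists of the characters
`x ↦ χ(u(n) a x)`. -/
lemma hasSum_sq_norm_setIntegral (hμ : μ {x : K | valuation K x ≤ 1} = 1) {a : K} (ha : a ≠ 0)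
    {h : K → ℂ} (hh : MemLp h 2 (μ.restrict (ball a))) :
    HasSum (fun n => ‖∫ x in ball a, h x * conj (S.χ (S.u n * (a * x)) : ℂ) ∂μ‖ ^ 2)
      ((modulus a)⁻¹ * ∫ x in ball a, ‖h x‖ ^ 2 ∂μ) := by
  have hm := modulus_pos K ha
  have : CompactSpace (ball a) := isCompact_iff_compactSpace.1 (isCompact_ball ha)
  have := S.pseudoMetrizableSpace
  have := S.secondCountableTopology
  have hmeas := measurableSet_ball a
  -- Haar measure scaled to total mass 1, which makes the characters orthonormal.
  let ν : Measure (ball a) := ENNReal.ofReal (modulus a) • μ.comap Subtype.val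
  have hint : ∀ f : K → ℂ, ∫ x, f x ∂ν = modulus a * ∫ x in ball a, f x ∂μ := fun f => by
    rw [integral_smul_measure, integral_subtype_comap hmeas, ENNReal.toReal_ofReal hm.le,
      Complex.real_smul]
  have hprob : IsProbabilityMeasure ν := ⟨by
    rw [Measure.smul_apply, comap_subtype_coe_apply hmeas, Set.image_univ, Subtype.range_coe,
      smul_eq_mul, S.modulus_mul_measure_ball hμ ha]⟩
  let e : ℕ → Lp ℂ 2 ν := fun n => ContinuousMap.toLp 2 ν ℂ (S.ballChar a n)
  have ho : Orthonormal ℂ e := by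
    rw [orthonormal_iff_ite]
    intro i j
    rw [ContinuousMap.inner_toLp]
    obtain ⟨k, hk⟩ := sub_mem (S.u_mem_lattice j) (S.u_mem_lattice i)
    have h1 : ∀ x : ball a, S.ballChar a j x * conj (S.ballChar a i x) =
        (fun x : K => (S.χ (S.u k * (a * x)) : ℂ)) x := fun x => by
      rw [ballChar_apply, ballChar_apply, conj_χ, ← χ_add, hk]; ring_nf
    simp_rw [h1]
    split_ifs with hij
    · subst hij
      rw [sub_self] at hk
      simp [hk]
    · rw [hint fun x : K => (S.χ (S.u k * (a * x)) : ℂ), S.setIntegral_χ_eq_zero ha, mul_zero]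
      rintro rfl
      rw [u_zero] at hk
      exact hij (S.u_injective (sub_eq_zero.1 hk.symm)).symm
  have hs : (Submodule.span ℂ (Set.range e)).topologicalClosure = ⊤ := by
    have h0 := (ContinuousMap.toLp_denseRange ℂ ν ℂ
      (ENNReal.ofNat_ne_top (n := 2))).topologicalClosure_map_submodule
      (S.span_ballChar_closure_eq_top ha)
    rw [Submodule.map_span, ← Set.range_comp] at h0
    exact h0
  let b := HilbertBasis.mk ho hs.ge
  have hh' : MemLp (fun x : ball a => h x) 2 ν := by
    refine MemLp.smul_measure ?_ ENNReal.ofReal_ne_top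
    rw [← map_comap_subtype_coe hmeas, (MeasurableEmbedding.subtype_coe hmeas).memLp_map_measure_iff]
      at hh
    exact hh
  have key := b.hasSum_inner_mul_inner (hh'.toLp _) (hh'.toLp _)
  have hcoef : ∀ n, inner ℂ (b n) (hh'.toLp _) =
      modulus a * ∫ x in ball a, h x * conj (S.χ (S.u n * (a * x)) : ℂ) ∂μ := fun n => by
    rw [HilbertBasis.coe_mk, L2.inner_def, ← hint]
    refine integral_congr_ae ?_
    filter_upwards [hh'.coeFn_toLp, ContinuousMap.coeFn_toLp (𝕜 := ℂ) (p := 2) ν (S.ballChar a n)]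
      with x hx1 hx2
    rw [hx1, hx2, RCLike.inner_apply, ballChar_apply]
  have hnorm : inner ℂ (hh'.toLp _) (hh'.toLp _) =
      ((modulus a * ∫ x in ball a, ‖h x‖ ^ 2 ∂μ : ℝ) : ℂ) := by
    rw [L2.inner_def, Complex.ofReal_mul, ← integral_complex_ofReal, ← hint]
    refine integral_congr_ae ?_
    filter_upwards [hh'.coeFn_toLp] with x hx1
    rw [hx1, inner_self_eq_norm_sq_to_K]
    simp
  rw [hnorm] at key
  have h2 : ∀ n, inner ℂ (hh'.toLp _) (b n) * inner ℂ (b n) (hh'.toLp _) =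
      (((modulus a) ^ 2 * ‖∫ x in ball a, h x * conj (S.χ (S.u n * (a * x)) : ℂ) ∂μ‖ ^ 2 : ℝ) : ℂ) :=
    fun n => by
      rw [← inner_conj_symm, hcoef, mul_comm, Complex.mul_conj', norm_mul, Complex.norm_real,
        Real.norm_of_nonneg hm.le]
      push_cast; ring
  simp_rw [h2] at key
  -- Each integral against `ν` carries a factor `|a|`: two on the coefficient side, one on the norm
  -- side. Dividing by `|a|²` leaves `|a|⁻¹`.
  have key2 := (Complex.hasSum_ofReal.1 key).mul_left ((modulus a)⁻¹ ^ 2)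
  have h3 : ∀ t : ℝ, (modulus a)⁻¹ ^ 2 * (modulus a ^ 2 * t) = t := fun t => by field_simp
  have h4 : ∀ t : ℝ, (modulus a)⁻¹ ^ 2 * (modulus a * t) = (modulus a)⁻¹ * t := fun t => by
    field_simp
  simpa only [h3, h4] using key2

end Parseval

end Coordinates

lemma eLpNorm_two_sq {α : Type*} [MeasurableSpace α] (μ : Measure α) (f : α → ℂ) :
    eLpNorm f 2 μ ^ 2 = ∫⁻ x, ‖f x‖ₑ ^ 2 ∂μ := by
  have := eLpNorm_nnreal_pow_eq_lintegral (f := f) (μ := μ) (p := 2) two_ne_zero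
  simpa using this

lemma enorm_sq_eq_ofReal (z : ℂ) : ‖z‖ₑ ^ 2 = ENNReal.ofReal (‖z‖ ^ 2) := by
  rw [ENNReal.ofReal_pow (norm_nonneg _), ofReal_norm]

lemma lintegral_enorm_sq_eq_ofReal {α : Type*} [MeasurableSpace α] {μ : Measure α} {f : α → ℂ}
    (hf : MemLp f 2 μ) : ∫⁻ x, ‖f x‖ₑ ^ 2 ∂μ = ENNReal.ofReal (∫ x, ‖f x‖ ^ 2 ∂μ) := by
  rw [ofReal_integral_eq_lintegral_ofReal hf.norm.integrable_sq
    (Eventually.of_forall fun _ => sq_nonneg _)]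
  simp_rw [enorm_sq_eq_ofReal]

namespace Coordinates

/-! ### Plancherel's theorem -/

section Fourier

variable {K : Type*} [Field K] [ValuativeRel K] [TopologicalSpace K]
  [IsNonarchimedeanLocalField K] [MeasurableSpace K] {p c : ℕ} (S : Coordinates K p c)
  {μ : Measure K}

lemma truncFourier_eq (f : K → ℂ) (j : ℕ) (ξ : K) :
    truncFourier S μ f j ξ = ∫ x in ball (S.π ^ j), f x * conj (S.χ (ξ * x) : ℂ) ∂μ := by
  rw [truncFourier, ball_pow_eq]

variable [BorelSpace K] [μ.IsAddHaarMeasure]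

lemma integrableOn_ball_mul_χ {f : K → ℂ} (hf : MemLp f 2 μ) (j : ℕ) (ξ : K) :
    Integrable (fun x => f x * conj (S.χ (ξ * x) : ℂ)) (μ.restrict (ball (S.π ^ j))) := by
  have : IsFiniteMeasure (μ.restrict (ball (S.π ^ j))) :=
    isFiniteMeasure_restrict.2 (measure_ball_ne_top (pow_ne_zero _ S.π_ne_zero))
  have h1 : Integrable f (μ.restrict (ball (S.π ^ j))) := (hf.restrict _).integrable one_le_two
  refine h1.mul_bdd (c := 1) ?_ (Eventually.of_forall fun x => ?_)
  · exact (Complex.continuous_conj.comp (S.continuous_χ_mul ξ)).aestronglyMeasurable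
  · rw [RCLike.norm_conj, Circle.norm_coe]

lemma truncFourier_add {f g : K → ℂ} (hf : MemLp f 2 μ) (hg : MemLp g 2 μ) (j : ℕ) :
    truncFourier S μ (f + g) j = truncFourier S μ f j + truncFourier S μ g j := by
  ext ξ
  simp_rw [Pi.add_apply, truncFourier_eq, Pi.add_apply, add_mul]
  exact integral_add (S.integrableOn_ball_mul_χ hf j ξ) (S.integrableOn_ball_mul_χ hg j ξ)

lemma truncFourier_smul (a : ℂ) (f : K → ℂ) (j : ℕ) :
    truncFourier S μ (a • f) j = a • truncFourier S μ f j := by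
  ext ξ
  simp_rw [Pi.smul_apply, truncFourier_eq, Pi.smul_apply, smul_eq_mul, mul_assoc,
    integral_const_mul]

lemma truncFourier_congr {f g : K → ℂ} (h : f =ᵐ[μ] g) (j : ℕ) :
    truncFourier S μ f j = truncFourier S μ g j := by
  ext ξ
  simp_rw [truncFourier_eq]
  refine integral_congr_ae ?_
  filter_upwards [ae_restrict_of_ae h] with x hx
  rw [hx]

lemma truncFourier_indicator {i j : ℕ} (hij : i ≤ j) (f : K → ℂ) :
    truncFourier S μ ((ball (S.π ^ i)).indicator f) j = truncFourier S μ f i := by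
  ext ξ
  simp_rw [truncFourier_eq]
  have : (fun x => (ball (S.π ^ i)).indicator f x * conj (S.χ (ξ * x) : ℂ)) =
      (ball (S.π ^ i)).indicator fun x => f x * conj (S.χ (ξ * x) : ℂ) := by
    ext x
    by_cases hx : x ∈ ball (S.π ^ i) <;> simp [hx]
  rw [this, setIntegral_indicator (measurableSet_ball _),
    Set.inter_eq_right.2 (S.monotone_ball_pow hij)]

/-- The product of a frequency in `π ^ j 𝔇` and a point of `π ^ (-j) 𝔇` is integral, where `χ` is
trivial. Truncated transforms are thus constant on cosets. -/
lemma truncFourier_add_of_mem (f : K → ℂ) (j : ℕ) (ξ : K) {η : K} (hη : η ∈ ball (S.π ^ j)⁻¹) :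
    truncFourier S μ f j (η + ξ) = truncFourier S μ f j ξ := by
  simp_rw [truncFourier_eq]
  refine setIntegral_congr_fun (measurableSet_ball _) fun x hx => ?_
  have h1 : valuation K (η * x) ≤ 1 := by
    have h2 : η * x = ((S.π ^ j)⁻¹ * η) * (S.π ^ j * x) := by
      have := pow_ne_zero j S.π_ne_zero
      field_simp
    rw [h2, map_mul]
    exact mul_le_one' hη hx
  simp only [add_mul]
  rw [AddChar.map_add_eq_mul, S.χ_integer h1, one_mul]

lemma continuous_truncFourier (f : K → ℂ) (j : ℕ) : Continuous (truncFourier S μ f j) := by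
  refine continuous_iff_continuousAt.2 fun ξ => ?_
  have h : truncFourier S μ f j =ᶠ[𝓝 ξ] fun _ => truncFourier S μ f j ξ := by
    have h1 : {x | x - ξ ∈ ball (S.π ^ j)⁻¹} ∈ 𝓝 ξ :=
      ((isOpen_ball _).preimage (continuous_sub_right ξ)).mem_nhds
        (by simpa using zero_mem_ball _)
    filter_upwards [h1] with x hx
    rw [← S.truncFourier_add_of_mem f j ξ hx, sub_add_cancel]
  exact continuousAt_const.congr h.symm

variable [Fact p.Prime] [CharP K p]

/-- On the tile of index `n` the truncated transform is constant, equal to a Fourier coefficient of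
`f` on `π ^ (-j) 𝔇`. Parseval sums their squares, and the volumes of the two dual balls cancel. -/
lemma lintegral_truncFourier_sq (hμ : μ {x : K | valuation K x ≤ 1} = 1) {f : K → ℂ}
    (hf : MemLp f 2 μ) (j : ℕ) :
    ∫⁻ ξ, ‖truncFourier S μ f j ξ‖ₑ ^ 2 ∂μ = ∫⁻ x in ball (S.π ^ j), ‖f x‖ₑ ^ 2 ∂μ := by
  have hπ := pow_ne_zero j S.π_ne_zero
  have hP := S.hasSum_sq_norm_setIntegral hμ hπ (hf.restrict _)
  have h1 : ∀ n, ∫⁻ x in ball (S.π ^ j)⁻¹,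
      ‖truncFourier S μ f j (x + (S.π ^ j)⁻¹⁻¹ * S.u n)‖ₑ ^ 2 ∂μ =
      ENNReal.ofReal (‖∫ x in ball (S.π ^ j),
        f x * conj (S.χ (S.u n * (S.π ^ j * x)) : ℂ) ∂μ‖ ^ 2) * μ (ball (S.π ^ j)⁻¹) := fun n => by
    rw [setLIntegral_congr_fun (measurableSet_ball _)
      (fun x hx => by rw [S.truncFourier_add_of_mem f j _ hx]), setLIntegral_const,
      enorm_sq_eq_ofReal, truncFourier_eq, inv_inv]
    simp_rw [show ∀ x, S.π ^ j * S.u n * x = S.u n * (S.π ^ j * x) from fun x => by ring]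
  rw [S.lintegral_eq_tsum μ (inv_ne_zero hπ)]
  simp_rw [h1]
  rw [ENNReal.tsum_mul_right, ← ENNReal.ofReal_tsum_of_nonneg (fun _ => sq_nonneg _) hP.summable,
    hP.tsum_eq, ENNReal.ofReal_mul (inv_nonneg.2 (modulus_pos K hπ).le), ← S.measure_ball hμ hπ,
    mul_right_comm, S.measure_ball_mul_measure_ball_inv hμ hπ, one_mul,
    lintegral_enorm_sq_eq_ofReal (hf.restrict _)]

lemma eLpNorm_truncFourier (hμ : μ {x : K | valuation K x ≤ 1} = 1) {f : K → ℂ}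
    (hf : MemLp f 2 μ) (j : ℕ) :
    eLpNorm (truncFourier S μ f j) 2 μ = eLpNorm ((ball (S.π ^ j)).indicator f) 2 μ := by
  refine (ENNReal.pow_right_strictMono two_ne_zero).injective ?_
  rw [eLpNorm_indicator_eq_eLpNorm_restrict (measurableSet_ball _), eLpNorm_two_sq, eLpNorm_two_sq,
    S.lintegral_truncFourier_sq hμ hf]

lemma memLp_truncFourier (hμ : μ {x : K | valuation K x ≤ 1} = 1) {f : K → ℂ}
    (hf : MemLp f 2 μ) (j : ℕ) : MemLp (truncFourier S μ f j) 2 μ := by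
  have := S.secondCountableTopology
  refine ⟨(S.continuous_truncFourier f j).aestronglyMeasurable, ?_⟩
  rw [S.eLpNorm_truncFourier hμ hf]
  exact (hf.indicator (measurableSet_ball _)).2

lemma tendsto_eLpNorm_sub_indicator {f : K → ℂ} (hf : MemLp f 2 μ) :
    Tendsto (fun j : ℕ => eLpNorm (f - (ball (S.π ^ j)).indicator f) 2 μ) atTop (𝓝 0) := by
  have h1 : Tendsto (fun j : ℕ => ∫⁻ x, ‖(f - (ball (S.π ^ j)).indicator f) x‖ₑ ^ 2 ∂μ)
      atTop (𝓝 (∫⁻ _, 0 ∂μ)) := by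
    refine tendsto_lintegral_of_dominated_convergence' (fun x => ‖f x‖ₑ ^ 2)
      (fun j => ?_) (fun j => Eventually.of_forall fun x => ?_) ?_
      (Eventually.of_forall fun x => ?_)
    · exact (hf.1.sub (hf.1.indicator (measurableSet_ball _))).enorm.pow_const 2
    · by_cases hx : x ∈ ball (S.π ^ j) <;> simp [hx]
    · rw [← eLpNorm_two_sq]; exact ENNReal.pow_ne_top hf.2.ne
    · obtain ⟨j, hj⟩ := S.exists_mem_ball_pow x
      refine tendsto_const_nhds.congr' ?_
      filter_upwards [eventually_ge_atTop j] with i hi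
      simp [S.monotone_ball_pow hi hj]
  simp_rw [← eLpNorm_two_sq] at h1
  have h2 := (ENNReal.continuous_rpow_const (y := (2⁻¹ : ℝ))).tendsto 0 |>.comp
    (by simpa using h1)
  have h3 : ∀ x : ℝ≥0∞, (x ^ 2) ^ (2⁻¹ : ℝ) = x := fun x => by
    rw [← ENNReal.rpow_natCast, ← ENNReal.rpow_mul]; norm_num
  simpa [Function.comp_def, h3] using h2

/-- With `eLpNorm_truncFourier`, bounds the differences of truncated transforms by an L² tail of
`f`, whence the Cauchy property. -/
lemma truncFourier_sub_truncFourier {f : K → ℂ} (hf : MemLp f 2 μ) {i j : ℕ} (hij : i ≤ j) :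
    truncFourier S μ f j - truncFourier S μ f i =
      truncFourier S μ (f - (ball (S.π ^ i)).indicator f) j := by
  have h := S.truncFourier_add (hf.sub (hf.indicator (measurableSet_ball (S.π ^ i))))
    (hf.indicator (measurableSet_ball (S.π ^ i))) j
  rw [sub_add_cancel, S.truncFourier_indicator hij] at h
  rw [h, add_sub_cancel_right]

/-- `F` is the Fourier transform of `f`: the truncated transforms of `f` converge to `F`
in `L²`. -/
def IsFourier (μ : Measure K) (f F : K → ℂ) : Prop :=
  MemLp F 2 μ ∧ Tendsto (fun j : ℕ => eLpNorm (truncFourier S μ f j - F) 2 μ) atTop (𝓝 0)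

lemma exists_isFourier (hμ : μ {x : K | valuation K x ≤ 1} = 1) {f : K → ℂ} (hf : MemLp f 2 μ) :
    ∃ F, S.IsFourier μ f F := by
  let t : ℕ → Lp ℂ 2 μ := fun j => (S.memLp_truncFourier hμ hf j).toLp _
  have hfin : ∀ j : ℕ, eLpNorm (f - (ball (S.π ^ j)).indicator f) 2 μ ≠ ∞ := fun j =>
    (hf.sub (hf.indicator (measurableSet_ball _))).2.ne
  have hC : CauchySeq t := by
    refine cauchySeq_of_le_tendsto_0'
      (fun j : ℕ => (eLpNorm (f - (ball (S.π ^ j)).indicator f) 2 μ).toReal) (fun i j hij => ?_) ?_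
    · rw [dist_comm, dist_eq_norm, ← MemLp.toLp_sub, Lp.norm_toLp]
      refine ENNReal.toReal_mono (hfin i) ?_
      rw [S.truncFourier_sub_truncFourier hf hij, S.eLpNorm_truncFourier hμ
        (hf.sub (hf.indicator (measurableSet_ball _)))]
      exact eLpNorm_indicator_le _
    · have := (ENNReal.tendsto_toReal ENNReal.zero_ne_top).comp (S.tendsto_eLpNorm_sub_indicator hf)
      simpa [Function.comp_def] using this
  obtain ⟨F, hF⟩ := cauchySeq_tendsto_of_complete hC
  refine ⟨F, Lp.memLp F, ?_⟩
  rw [Lp.tendsto_Lp_iff_tendsto_eLpNorm'] at hF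
  refine hF.congr fun j => eLpNorm_congr_ae ?_
  exact (MemLp.coeFn_toLp _).sub (EventuallyEq.refl _ _)

lemma isFourier_fourier (hμ : μ {x : K | valuation K x ≤ 1} = 1) {f : K → ℂ} (hf : MemLp f 2 μ) :
    S.IsFourier μ f (fourier S μ f) := by
  have h := S.exists_isFourier hμ hf
  have h2 := h.choose_spec
  have h3 : fourier S μ f = h.choose := dif_pos h
  rw [h3]; exact h2

namespace IsFourier

variable {S}

lemma ae_eq (hμ : μ {x : K | valuation K x ≤ 1} = 1) {f F G : K → ℂ} (hf : MemLp f 2 μ)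
    (hF : S.IsFourier μ f F) (hG : S.IsFourier μ f G) : F =ᵐ[μ] G := by
  have h1 : Tendsto (fun j : ℕ => eLpNorm (truncFourier S μ f j - G) 2 μ +
      eLpNorm (truncFourier S μ f j - F) 2 μ) atTop (𝓝 0) := by
    simpa using hG.2.add hF.2
  have h2 : eLpNorm (F - G) 2 μ ≤ 0 := by
    refine ge_of_tendsto' h1 fun j => ?_
    have hT := S.memLp_truncFourier hμ hf j
    calc eLpNorm (F - G) 2 μ
        = eLpNorm ((truncFourier S μ f j - G) - (truncFourier S μ f j - F)) 2 μ := by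
          congr 1; abel
      _ ≤ _ := eLpNorm_sub_le (hT.sub hG.1).1 (hT.sub hF.1).1 one_le_two
  rw [nonpos_iff_eq_zero, eLpNorm_eq_zero_iff (hF.1.sub hG.1).1 two_ne_zero] at h2
  filter_upwards [h2] with x hx
  exact sub_eq_zero.1 hx

lemma congr_left {f g F : K → ℂ} (h : f =ᵐ[μ] g) (hF : S.IsFourier μ f F) :
    S.IsFourier μ g F := by
  refine ⟨hF.1, ?_⟩
  simp_rw [← S.truncFourier_congr h]
  exact hF.2

lemma add (hμ : μ {x : K | valuation K x ≤ 1} = 1) {f g F G : K → ℂ} (hf : MemLp f 2 μ)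
    (hg : MemLp g 2 μ) (hF : S.IsFourier μ f F) (hG : S.IsFourier μ g G) :
    S.IsFourier μ (f + g) (F + G) := by
  refine ⟨hF.1.add hG.1, ?_⟩
  refine tendsto_of_tendsto_of_tendsto_of_le_of_le tendsto_const_nhds
    (by simpa using hF.2.add hG.2) (fun _ => zero_le) fun j => ?_
  simp only [S.truncFourier_add hf hg, add_sub_add_comm]
  exact eLpNorm_add_le ((S.memLp_truncFourier hμ hf j).sub hF.1).1
    ((S.memLp_truncFourier hμ hg j).sub hG.1).1 one_le_two

lemma smul (a : ℂ) {f F : K → ℂ} (hF : S.IsFourier μ f F) : S.IsFourier μ (a • f) (a • F) := by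
  refine ⟨hF.1.const_smul a, ?_⟩
  simp_rw [S.truncFourier_smul, ← smul_sub, eLpNorm_const_smul]
  simpa using ENNReal.Tendsto.const_mul hF.2 (Or.inr (enorm_ne_top (x := a)))

lemma eLpNorm_eq (hμ : μ {x : K | valuation K x ≤ 1} = 1) {f F : K → ℂ} (hf : MemLp f 2 μ)
    (hF : S.IsFourier μ f F) : eLpNorm F 2 μ = eLpNorm f 2 μ := by
  have hf0 := S.tendsto_eLpNorm_sub_indicator hf
  have hI : ∀ j : ℕ, MemLp ((ball (S.π ^ j)).indicator f) 2 μ := fun j =>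
    hf.indicator (measurableSet_ball _)
  have hT := S.memLp_truncFourier hμ hf
  apply le_antisymm
  · have h1 : Tendsto (fun j : ℕ => eLpNorm f 2 μ + eLpNorm (truncFourier S μ f j - F) 2 μ) atTop
        (𝓝 (eLpNorm f 2 μ)) := by simpa using tendsto_const_nhds.add hF.2
    refine ge_of_tendsto' h1 fun j => ?_
    calc eLpNorm F 2 μ = eLpNorm (truncFourier S μ f j - (truncFourier S μ f j - F)) 2 μ := by
          congr 1; abel
      _ ≤ eLpNorm (truncFourier S μ f j) 2 μ + _ :=
          eLpNorm_sub_le (hT j).1 ((hT j).sub hF.1).1 one_le_two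
      _ ≤ _ := by
          rw [S.eLpNorm_truncFourier hμ hf]
          gcongr
          exact eLpNorm_indicator_le _
  · have h1 : Tendsto (fun j : ℕ => eLpNorm (f - (ball (S.π ^ j)).indicator f) 2 μ +
        (eLpNorm (truncFourier S μ f j - F) 2 μ + eLpNorm F 2 μ)) atTop
        (𝓝 (eLpNorm F 2 μ)) := by simpa using hf0.add (hF.2.add_const _)
    refine ge_of_tendsto' h1 fun j => ?_
    calc eLpNorm f 2 μ = eLpNorm (f - (ball (S.π ^ j)).indicator f +
          (ball (S.π ^ j)).indicator f) 2 μ := by congr 1; abel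
      _ ≤ _ + eLpNorm ((ball (S.π ^ j)).indicator f) 2 μ :=
          eLpNorm_add_le (hf.sub (hI j)).1 (hI j).1 one_le_two
      _ ≤ _ := by
          rw [← S.eLpNorm_truncFourier hμ hf]
          gcongr
          calc eLpNorm (truncFourier S μ f j) 2 μ
              = eLpNorm (truncFourier S μ f j - F + F) 2 μ := by congr 1; abel
            _ ≤ _ := eLpNorm_add_le ((hT j).sub hF.1).1 hF.1.1 one_le_two

/-- The Fourier transform turns modulations into translations. -/
lemma modulation (t : K) {f F : K → ℂ} (hμ : μ {x : K | valuation K x ≤ 1} = 1)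
    (hf : MemLp f 2 μ) (hF : S.IsFourier μ f F) :
    S.IsFourier μ (fun x => (S.χ (t * x) : ℂ) * f x) (fun ξ => F (ξ - t)) := by
  have hmp := measurePreserving_sub_right μ t
  refine ⟨hF.1.comp_measurePreserving hmp, hF.2.congr fun j => ?_⟩
  rw [← eLpNorm_comp_measurePreserving ((S.memLp_truncFourier hμ hf j).sub hF.1).1 hmp]
  congr 1
  ext ξ
  simp only [Function.comp_apply, Pi.sub_apply, truncFourier_eq]
  congr 2
  ext x
  rw [sub_mul, sub_eq_add_neg, χ_add, map_mul, conj_χ _ (-_), neg_neg]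
  ring

/-- The Fourier transform turns translations into modulations. -/
lemma translation (s : K) {f F : K → ℂ} (hF : S.IsFourier μ f F) :
    S.IsFourier μ (fun x => f (x - s)) (fun ξ => conj (S.χ (ξ * s) : ℂ) * F ξ) := by
  have hm : ∀ G : K → ℂ, eLpNorm (fun ξ => conj (S.χ (ξ * s) : ℂ) * G ξ) 2 μ = eLpNorm G 2 μ :=
    fun G => eLpNorm_congr_norm_ae (Eventually.of_forall fun ξ => by
      rw [norm_mul, RCLike.norm_conj, Circle.norm_coe, one_mul])
  have hc : Continuous fun ξ : K => conj (S.χ (ξ * s) : ℂ) := by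
    simpa [mul_comm, Function.comp_def] using Complex.continuous_conj.comp (S.continuous_χ_mul s)
  refine ⟨⟨hc.aestronglyMeasurable.mul hF.1.1, by rw [hm]; exact hF.1.2⟩, hF.2.congr' ?_⟩
  -- Once the ball contains `s` it is invariant under translation by `s`, so the identity is exact
  -- for truncated transforms.
  obtain ⟨j, hj⟩ := S.exists_mem_ball_pow s
  filter_upwards [eventually_ge_atTop j] with i hi
  rw [← hm]
  congr 1
  ext ξ
  simp only [Pi.sub_apply, mul_sub, truncFourier_eq]
  congr 1
  rw [← integral_const_mul, ← setIntegral_ball_add (S.monotone_ball_pow hi hj)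
    fun x => f (x - s) * conj (S.χ (ξ * x) : ℂ)]
  congr 1
  ext x
  rw [add_sub_cancel_right, mul_add, χ_add, (starRingEnd ℂ).map_mul]
  ring

end IsFourier

lemma isFourier_truncFourier (hμ : μ {x : K | valuation K x ≤ 1} = 1) {f : K → ℂ}
    (hf : MemLp f 2 μ) (j : ℕ) :
    S.IsFourier μ ((ball (S.π ^ j)).indicator f) (truncFourier S μ f j) := by
  refine ⟨S.memLp_truncFourier hμ hf j, tendsto_const_nhds.congr' ?_⟩
  filter_upwards [eventually_ge_atTop j] with i hi
  rw [S.truncFourier_indicator hi, sub_self, eLpNorm_zero]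

/-- The Fourier transform as a linear isometry of `L²(K)`. -/
def fourierIsometry (hμ : μ {x : K | valuation K x ≤ 1} = 1) : Lp ℂ 2 μ →ₗᵢ[ℂ] Lp ℂ 2 μ where
  toFun f := (S.isFourier_fourier hμ (Lp.memLp f)).1.toLp _
  map_add' f g := by
    rw [← MemLp.toLp_add, MemLp.toLp_eq_toLp_iff]
    have h1 := (S.isFourier_fourier hμ (Lp.memLp f)).add hμ (Lp.memLp f) (Lp.memLp g)
      (S.isFourier_fourier hμ (Lp.memLp g))
    exact (S.isFourier_fourier hμ (Lp.memLp (f + g))).ae_eq hμ (Lp.memLp _)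
      (h1.congr_left (Lp.coeFn_add f g).symm)
  map_smul' a f := by
    rw [RingHom.id_apply, ← MemLp.toLp_const_smul, MemLp.toLp_eq_toLp_iff]
    have h1 := (S.isFourier_fourier hμ (Lp.memLp f)).smul a
    exact (S.isFourier_fourier hμ (Lp.memLp (a • f))).ae_eq hμ (Lp.memLp _)
      (h1.congr_left (Lp.coeFn_smul a f).symm)
  norm_map' f := by
    change ‖MemLp.toLp _ (S.isFourier_fourier hμ (Lp.memLp f)).1‖ = _
    rw [Lp.norm_toLp, (S.isFourier_fourier hμ (Lp.memLp f)).eLpNorm_eq hμ (Lp.memLp f), Lp.norm_def]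

lemma coeFn_fourierIsometry (hμ : μ {x : K | valuation K x ≤ 1} = 1) (f : Lp ℂ 2 μ) :
    S.fourierIsometry hμ f =ᵐ[μ] fourier S μ f :=
  MemLp.coeFn_toLp (S.isFourier_fourier hμ (Lp.memLp f)).1

lemma coeFn_fourierIsometry_of_isFourier (hμ : μ {x : K | valuation K x ≤ 1} = 1) {f : Lp ℂ 2 μ}
    {F : K → ℂ} (h : S.IsFourier μ f F) : S.fourierIsometry hμ f =ᵐ[μ] F :=
  (S.coeFn_fourierIsometry hμ f).trans
    ((S.isFourier_fourier hμ (Lp.memLp f)).ae_eq hμ (Lp.memLp f) h)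

end Fourier

/-! ### A dense space of functions with bounded, compactly supported transform -/

section TestFunctions

variable {K : Type*} [Field K] [ValuativeRel K] [TopologicalSpace K]
  [IsNonarchimedeanLocalField K] [MeasurableSpace K] [BorelSpace K]
  {p c : ℕ} [Fact p.Prime] [CharP K p] (S : Coordinates K p c)
  {μ : Measure K} [μ.IsAddHaarMeasure]

lemma setIntegral_χ_mul_eq_zero {j : ℕ} {t : K} (ht : t ∉ ball (S.π ^ j)⁻¹) :
    ∫ x in ball (S.π ^ j), (S.χ (t * x) : ℂ) ∂μ = 0 := by
  have ht0 : t ≠ 0 := fun h => ht (h ▸ zero_mem_ball _)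
  -- Translation by this point multiplies the integrand by `χ(π⁻¹) ≠ 1`.
  have hy : t⁻¹ * S.π⁻¹ ∈ ball (S.π ^ j) := by
    rw [mem_ball, ← mul_assoc]
    apply S.val_le_π
    rw [mem_ball, not_le] at ht
    have : S.π ^ j * t⁻¹ = ((S.π ^ j)⁻¹ * t)⁻¹ := by rw [mul_inv, inv_inv]
    rw [this, map_inv₀]
    exact inv_lt_one_of_one_lt₀ ht
  have h1 := setIntegral_ball_add (μ := μ) hy fun x => (S.χ (t * x) : ℂ)
  simp_rw [mul_add, mul_inv_cancel_left₀ ht0, χ_add, integral_mul_const] at h1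
  have h2 : (S.χ S.π⁻¹ : ℂ) ≠ 1 := fun h' => S.χ_inv_π (Circle.ext h')
  by_contra h3
  exact h2 (mul_left_cancel₀ h3 (h1.trans (mul_one _).symm))

/-- Essentially bounded functions vanishing almost everywhere outside a ball. -/
def IsBoundedSupp (μ : Measure K) (F : K → ℂ) : Prop :=
  ∃ (M : ℕ) (C : ℝ), ∀ᵐ x ∂μ, ‖F x‖ ≤ C ∧ (x ∉ ball (S.π ^ M) → F x = 0)

/-- The `L²` functions whose Fourier transform is bounded and compactly supported. -/
def testSubmodule (hμ : μ {x : K | valuation K x ≤ 1} = 1) : Submodule ℂ (Lp ℂ 2 μ) where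
  carrier := {f | S.IsBoundedSupp μ (S.fourierIsometry hμ f)}
  zero_mem' := by
    refine ⟨0, 0, ?_⟩
    rw [map_zero]
    filter_upwards [Lp.coeFn_zero ℂ 2 μ] with x hx
    rw [hx]
    simp
  add_mem' := by
    rintro f g ⟨M, C, hf⟩ ⟨N, D, hg⟩
    refine ⟨max M N, C + D, ?_⟩
    rw [map_add]
    filter_upwards [Lp.coeFn_add (S.fourierIsometry hμ f) (S.fourierIsometry hμ g), hf, hg]
      with x hx hfx hgx
    rw [hx, Pi.add_apply]
    refine ⟨(norm_add_le _ _).trans (add_le_add hfx.1 hgx.1), fun h => ?_⟩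
    rw [hfx.2 fun h' => h (S.monotone_ball_pow (le_max_left _ _) h'),
      hgx.2 fun h' => h (S.monotone_ball_pow (le_max_right _ _) h'), add_zero]
  smul_mem' := by
    rintro a f ⟨M, C, hf⟩
    refine ⟨M, ‖a‖ * C, ?_⟩
    rw [map_smul]
    filter_upwards [Lp.coeFn_smul a (S.fourierIsometry hμ f), hf] with x hx hfx
    rw [hx, Pi.smul_apply, norm_smul]
    exact ⟨mul_le_mul_of_nonneg_left hfx.1 (norm_nonneg _), fun h => by rw [hfx.2 h, smul_zero]⟩

/-- The character `x ↦ χ(t x)` cut off to `𝔭⁻ʲ 𝔇`. -/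
def cutChar (j : ℕ) (t : K) : K → ℂ := (ball (S.π ^ j)).indicator fun x => (S.χ (t * x) : ℂ)

lemma memLp_cutChar (j : ℕ) (t : K) : MemLp (S.cutChar j t) 2 μ := by
  have := S.secondCountableTopology
  have : IsFiniteMeasure (μ.restrict (ball (S.π ^ j))) :=
    isFiniteMeasure_restrict.2 (measure_ball_ne_top (pow_ne_zero _ S.π_ne_zero))
  rw [cutChar, memLp_indicator_iff_restrict (measurableSet_ball _)]
  exact MemLp.of_bound (S.continuous_χ_mul t).aestronglyMeasurable 1
    (Eventually.of_forall fun x => by rw [Circle.norm_coe])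

lemma truncFourier_cutChar (j : ℕ) (t ξ : K) :
    truncFourier S μ (S.cutChar j t) j ξ = ∫ x in ball (S.π ^ j), (S.χ ((t - ξ) * x) : ℂ) ∂μ := by
  rw [truncFourier_eq]
  refine setIntegral_congr_fun (measurableSet_ball _) fun x hx => ?_
  simp only [cutChar, Set.indicator_of_mem hx]
  rw [conj_χ, ← χ_add]
  ring_nf

/-- The transform is an explicit character integral that vanishes off the coset `t + π ^ j 𝔇`. -/
lemma cutChar_mem_testSubmodule (hμ : μ {x : K | valuation K x ≤ 1} = 1) (j : ℕ) (t : K) :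
    (S.memLp_cutChar (μ := μ) j t).toLp _ ∈ S.testSubmodule hμ := by
  have hcc : (ball (S.π ^ j)).indicator (S.cutChar j t) = S.cutChar j t := by
    rw [cutChar, Set.indicator_indicator, Set.inter_self]
  have hF := S.isFourier_truncFourier hμ (S.memLp_cutChar (μ := μ) j t) j
  rw [hcc] at hF
  have hF' := S.coeFn_fourierIsometry_of_isFourier hμ
    (hF.congr_left (S.memLp_cutChar (μ := μ) j t).coeFn_toLp.symm)
  obtain ⟨M, hM⟩ := S.exists_mem_ball_pow t
  obtain ⟨N, hN⟩ := S.exists_ball_subset (inv_ne_zero (pow_ne_zero j S.π_ne_zero))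
  refine ⟨max M N, 1 * μ.real (ball (S.π ^ j)), ?_⟩
  filter_upwards [hF'] with ξ hξ
  rw [hξ, truncFourier_cutChar]
  refine ⟨norm_setIntegral_le_of_norm_le_const
    (measure_ball_ne_top (pow_ne_zero _ S.π_ne_zero)).lt_top
    fun x _ => by rw [Circle.norm_coe], fun h => S.setIntegral_χ_mul_eq_zero fun h' => h ?_⟩
  have := sub_mem_ball (S.monotone_ball_pow (le_max_left M N) hM)
    (S.monotone_ball_pow (le_max_right M N) (hN h'))
  simpa using this

/-- A function orthogonal to all cut-off characters has zero Fourier coefficients on every ball, so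
it vanishes by Parseval. -/
lemma dense_testSubmodule (hμ : μ {x : K | valuation K x ≤ 1} = 1) :
    (S.testSubmodule hμ).topologicalClosure = ⊤ := by
  rw [Submodule.topologicalClosure_eq_top_iff, Submodule.eq_bot_iff]
  intro f hf
  have h1 : ∀ j : ℕ, ∀ᵐ x ∂μ, x ∈ ball (S.π ^ j) → f x = 0 := fun j => by
    have hπ := pow_ne_zero j S.π_ne_zero
    have hP := S.hasSum_sq_norm_setIntegral hμ hπ ((Lp.memLp f).restrict _)
    have h0 : ∀ n, ∫ x in ball (S.π ^ j), f x * conj (S.χ (S.u n * (S.π ^ j * x)) : ℂ) ∂μ = 0 := by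
      intro n
      have h := (Submodule.mem_orthogonal _ _).1 hf _
        (S.cutChar_mem_testSubmodule hμ j (S.u n * S.π ^ j))
      rw [L2.inner_def] at h
      rw [← h, ← integral_indicator (measurableSet_ball _)]
      refine integral_congr_ae ?_
      filter_upwards [(S.memLp_cutChar (μ := μ) j (S.u n * S.π ^ j)).coeFn_toLp] with x hx
      rw [hx, RCLike.inner_apply, cutChar]
      by_cases hxb : x ∈ ball (S.π ^ j) <;> simp [hxb, mul_assoc]
    simp_rw [h0, norm_zero, zero_pow two_ne_zero] at hP
    have h2 := hP.unique hasSum_zero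
    have h3 : ∫ x in ball (S.π ^ j), ‖f x‖ ^ 2 ∂μ = 0 := by
      rcases mul_eq_zero.1 h2 with h | h
      · exact absurd h (inv_ne_zero (modulus_pos K hπ).ne')
      · exact h
    rw [integral_eq_zero_iff_of_nonneg (fun _ => sq_nonneg _)
      ((Lp.memLp f).restrict _).norm.integrable_sq] at h3
    rw [← ae_restrict_iff' (measurableSet_ball _)]
    filter_upwards [h3] with x hx
    simpa using hx
  rw [← ae_all_iff] at h1
  refine Lp.ext ?_
  filter_upwards [h1, Lp.coeFn_zero ℂ 2 μ] with x hx h0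
  obtain ⟨j, hj⟩ := S.exists_mem_ball_pow x
  rw [hx j hj, h0, Pi.zero_apply]

end TestFunctions

/-! ### Periodization over the lattice -/

section Periodization

variable {K : Type*} [Field K] [ValuativeRel K] [TopologicalSpace K]
  [IsNonarchimedeanLocalField K] {p c : ℕ} [Fact p.Prime] [CharP K p] (S : Coordinates K p c)

/-- The bijection of `ℕ` with the lattice. -/
def uEquiv : ℕ ≃ S.lattice :=
  Equiv.ofBijective (fun n => ⟨S.u n, S.u_mem_lattice n⟩)
    ⟨fun _ _ h => S.u_injective (congrArg Subtype.val h), fun ⟨_, n, h⟩ => ⟨n, Subtype.ext h⟩⟩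

lemma u_uEquiv_symm (x : S.lattice) : S.u (S.uEquiv.symm x) = x :=
  congrArg Subtype.val (S.uEquiv.apply_symm_apply x)

/-- The permutation of `ℕ` corresponding to translation by `u(n)` on the lattice. -/
def shiftEquiv (n : ℕ) : ℕ ≃ ℕ :=
  (S.uEquiv.trans (Equiv.addLeft (S.uEquiv n))).trans S.uEquiv.symm

lemma u_shiftEquiv (n k : ℕ) : S.u (S.shiftEquiv n k) = S.u n + S.u k :=
  S.u_uEquiv_symm _

/-- The permutation of `ℕ` corresponding to negation on the lattice. -/
def negEquiv : ℕ ≃ ℕ := (S.uEquiv.trans (Equiv.neg _)).trans S.uEquiv.symm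

lemma u_negEquiv (k : ℕ) : S.u (S.negEquiv k) = -S.u k := S.u_uEquiv_symm _

lemma negEquiv_eq_zero_iff {k : ℕ} : S.negEquiv k = 0 ↔ k = 0 := by
  rw [← S.u_injective.eq_iff, u_negEquiv, u_zero, neg_eq_zero, ← S.u_zero, S.u_injective.eq_iff]

lemma finite_u_mem_ball (j : ℕ) {a : K} (ha : a ≠ 0) :
    {k : ℕ | a⁻¹ * S.u k ∈ ball (S.π ^ j)}.Finite := by
  obtain ⟨N, hN⟩ := S.exists_le_pow (valuation K a * (valuation K S.π)⁻¹ ^ j)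
  refine (Set.finite_Iio ((p ^ c) ^ N)).subset fun k hk => ?_
  by_contra h
  have h1 := S.inv_pow_le_val_u_of_le (not_lt.1 h)
  have h2 : valuation K (S.u k) ≤ valuation K a * (valuation K S.π)⁻¹ ^ j := by
    have h3 := S.mem_ball_pow.1 hk
    rwa [map_mul, map_inv₀, inv_mul_le_iff₀ (by simpa [zero_lt_iff] using ha)] at h3
  exact absurd (h1.trans (h2.trans hN)) (not_le.2
    (pow_lt_pow_right₀ ((one_lt_inv₀ S.val_π_pos).2 S.π_lt_one) (Nat.lt_succ_self N)))

/-- The sum of `h` over the translates by the lattice `a⁻¹ u(k)`. -/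
def periodize (a : K) (h : K → ℂ) (x : K) : ℂ := ∑' k, h (x + a⁻¹ * S.u k)

lemma periodize_add (a : K) (h : K → ℂ) (x : K) (n : ℕ) :
    S.periodize a h (x + a⁻¹ * S.u n) = S.periodize a h x := by
  rw [periodize, periodize, ← (S.shiftEquiv n).tsum_eq fun k => h (x + a⁻¹ * S.u k)]
  simp_rw [u_shiftEquiv, mul_add, add_assoc]

variable [MeasurableSpace K] [BorelSpace K] {μ : Measure K} [μ.IsAddHaarMeasure]

/-- For square integrable `h` with compact support, the square sum of the values of the Fourier
transform of `h` on a lattice is a finite sum of autocorrelations. -/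
lemma exists_hasSum_sq_norm_integral (hμ : μ {x : K | valuation K x ≤ 1} = 1) {a : K} (ha : a ≠ 0)
    {h : K → ℂ} (hh : MemLp h 2 μ) {M : ℕ} (hM : ∀ x, x ∉ ball (S.π ^ M) → h x = 0)
    {L : Finset ℕ} (hL : ∀ k, a⁻¹ * S.u k ∈ ball (S.π ^ M) → k ∈ L) :
    ∃ R : ℝ, HasSum (fun n => ‖∫ x, h x * (S.χ (S.u n * (a * x)) : ℂ) ∂μ‖ ^ 2) R ∧
      (R : ℂ) = ((modulus a)⁻¹ : ℝ) * ∑ l ∈ L, ∫ x, h x * conj (h (x + a⁻¹ * S.u l)) ∂μ := by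
  obtain ⟨N, hN⟩ := S.exists_ball_subset ha
  -- Translates that can bring a point of the fundamental domain into the support; `L` instead
  -- concerns differences of two points of the support.
  let L' := (S.finite_u_mem_ball (max M N) ha).toFinset
  have hL' : ∀ x ∈ ball a, ∀ k, k ∉ L' → x + a⁻¹ * S.u k ∉ ball (S.π ^ M) := by
    intro x hx k hk hmem
    refine hk ((Set.Finite.mem_toFinset _).2 ?_)
    have := sub_mem_ball (S.monotone_ball_pow (le_max_left M N) hmem)
      (S.monotone_ball_pow (le_max_right M N) (hN hx))
    simpa using this
  have hshift : ∀ k, MemLp (fun x => h (x + a⁻¹ * S.u k)) 2 μ := fun k =>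
    hh.comp_measurePreserving (measurePreserving_add_right μ _)
  have hH : ∀ x ∈ ball a, S.periodize a h x = ∑ k ∈ L', h (x + a⁻¹ * S.u k) := fun x hx =>
    tsum_eq_sum fun k hk => hM _ (hL' x hx k hk)
  have hfin : IsFiniteMeasure (μ.restrict (ball (S.π ^ M))) :=
    isFiniteMeasure_restrict.2 (measure_ball_ne_top (pow_ne_zero _ S.π_ne_zero))
  have hfin' : IsFiniteMeasure (μ.restrict (ball a)) :=
    isFiniteMeasure_restrict.2 (measure_ball_ne_top ha)
  have hint : Integrable h μ := by
    have : IntegrableOn h (ball (S.π ^ M)) μ := (hh.restrict _).integrable one_le_two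
    exact this.integrable_of_forall_notMem_eq_zero hM
  -- an integral over `K` of a function supported on the ball is a finite sum over tiles
  have unfold : ∀ f : K → ℂ, Integrable f μ → (∀ x, h x = 0 → f x = 0) →
      ∫ x, f x ∂μ = ∫ x in ball a, ∑ k ∈ L', f (x + a⁻¹ * S.u k) ∂μ := by
    intro f hf h0
    have h1 := (S.hasSum_setIntegral_ball ha hf).tsum_eq
    rw [tsum_eq_sum (s := L')] at h1
    · rw [← h1, integral_finsetSum]
      intro k _
      exact (hf.comp_add_right _).integrableOn
    · intro k hk
      rw [setIntegral_congr_fun (g := fun _ => 0) (measurableSet_ball a)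
        fun x hx => h0 _ (hM _ (hL' x hx k hk))]
      simp
  have hHmem : MemLp (S.periodize a h) 2 (μ.restrict (ball a)) := by
    have : MemLp (fun x => ∑ k ∈ L', h (x + a⁻¹ * S.u k)) 2 (μ.restrict (ball a)) :=
      memLp_finsetSum L' fun k _ => (hshift k).restrict _
    refine this.ae_eq ?_
    filter_upwards [ae_restrict_mem (measurableSet_ball a)] with x hx
    exact (hH x hx).symm
  -- The lattice shifts disappear from the character by `χ_u_mul_u`. The outer conjugate arises
  -- because `χ` enters here unconjugated.
  have hcoef : ∀ n, ∫ x, h x * (S.χ (S.u n * (a * x)) : ℂ) ∂μ =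
      conj (∫ x in ball a, conj (S.periodize a h x) * conj (S.χ (S.u n * (a * x)) : ℂ) ∂μ) := by
    intro n
    rw [← integral_conj, unfold]
    · refine setIntegral_congr_fun (measurableSet_ball a) fun x hx => ?_
      simp only [map_mul, Complex.conj_conj, hH x hx, Finset.sum_mul]
      refine Finset.sum_congr rfl fun k _ => ?_
      rw [mul_add, mul_inv_cancel_left₀ ha, mul_add (S.u n), χ_add, S.χ_u_mul_u, Circle.coe_one,
        mul_one]
    · refine hint.mul_bdd (c := 1) ?_ (Eventually.of_forall fun x => by rw [Circle.norm_coe])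
      simpa [mul_assoc] using (S.continuous_χ_mul (S.u n * a)).aestronglyMeasurable
    · intro x hx
      rw [hx, zero_mul]
  have hP := S.hasSum_sq_norm_setIntegral hμ ha hHmem.star
  refine ⟨(modulus a)⁻¹ * ∫ x in ball a, ‖star (S.periodize a h) x‖ ^ 2 ∂μ, ?_, ?_⟩
  · simp_rw [hcoef, RCLike.norm_conj]
    exact hP
  · have hterm : ∀ l, Integrable (fun x => h x * conj (h (x + a⁻¹ * S.u l))) μ := fun l =>
      hh.integrable_mul (hshift l).star
    have hexp : ∀ x, h x * conj (S.periodize a h x) =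
        ∑ l ∈ L, h x * conj (h (x + a⁻¹ * S.u l)) := by
      intro x
      by_cases hx : h x = 0
      · simp [hx]
      · have hxM : x ∈ ball (S.π ^ M) := by
          by_contra hx'
          exact hx (hM x hx')
        rw [periodize, tsum_eq_sum (s := L), map_sum, Finset.mul_sum]
        intro k hk
        refine hM _ fun h' => hk (hL k ?_)
        simpa using sub_mem_ball h' hxM
    rw [Complex.ofReal_mul, ← integral_finsetSum _ fun l _ => hterm l]
    simp_rw [← hexp]
    -- The periodization is lattice invariant, so folding this integral periodizes the factor `h`
    -- too and produces a squared modulus.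
    rw [unfold (fun x => h x * conj (S.periodize a h x))]
    · rw [← integral_complex_ofReal]
      congr 1
      refine setIntegral_congr_fun (measurableSet_ball a) fun x hx => ?_
      simp only [periodize_add, ← Finset.sum_mul, Pi.star_apply, norm_star]
      rw [← hH x hx, Complex.mul_conj']
      push_cast
      rfl
    · simp_rw [hexp]
      exact integrable_finsetSum _ fun l _ => hterm l
    · intro x hx
      rw [hx, zero_mul]

end Periodization

end Coordinates

/-! ### Elementary inequalities and extension by density -/

lemma two_mul_enorm_mul_enorm_le (x y : ℂ) : 2 * (‖x‖ₑ * ‖y‖ₑ) ≤ ‖x‖ₑ ^ 2 + ‖y‖ₑ ^ 2 := by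
  have h : 2 * (‖x‖₊ * ‖y‖₊) ≤ ‖x‖₊ ^ 2 + ‖y‖₊ ^ 2 := by
    rw [← mul_assoc]; exact two_mul_le_add_sq _ _
  simp only [enorm_eq_nnnorm]
  exact_mod_cast h

lemma enorm_mul_enorm_le (x y : ℂ) : ‖x‖ₑ * ‖y‖ₑ ≤ ‖x‖ₑ ^ 2 + ‖y‖ₑ ^ 2 :=
  le_trans (by rw [two_mul]; exact le_self_add) (two_mul_enorm_mul_enorm_le x y)

/-- The frame inequalities extend from a dense subspace to the whole space. -/
lemma isFrameWithBounds_of_dense {ι H : Type*} [NormedAddCommGroup H] [InnerProductSpace ℂ H]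
    {e : ι → H} {A B : ℝ} (hA : 0 < A) (hAB : A ≤ B) {V : Submodule ℂ H}
    (hV : V.topologicalClosure = ⊤)
    (h : ∀ f ∈ V, Summable (fun i => ‖inner ℂ (e i) f‖ ^ 2) ∧
      A * ‖f‖ ^ 2 ≤ ∑' i, ‖inner ℂ (e i) f‖ ^ 2 ∧ ∑' i, ‖inner ℂ (e i) f‖ ^ 2 ≤ B * ‖f‖ ^ 2) :
    IsFrameWithBounds e A B := by
  have hd : Dense (V : Set H) := (Submodule.dense_iff_topologicalClosure_eq_top).2 hV
  have hs : ∀ (f : H) (s : Finset ι), ∑ i ∈ s, ‖inner ℂ (e i) f‖ ^ 2 ≤ B * ‖f‖ ^ 2 := by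
    intro f s
    have hc : IsClosed {f : H | ∑ i ∈ s, ‖inner ℂ (e i) f‖ ^ 2 ≤ B * ‖f‖ ^ 2} :=
      isClosed_le (by fun_prop) (by fun_prop)
    exact hc.closure_subset_iff.2 (fun f hf => ((h f hf).1.sum_le_tsum s
      fun _ _ => sq_nonneg _).trans (h f hf).2.2) (hd f)
  have hsum : ∀ f, Summable (fun i => ‖inner ℂ (e i) f‖ ^ 2) := fun f =>
    summable_of_sum_le (fun _ => sq_nonneg _) (hs f)
  have hle : ∀ f, ∑' i, ‖inner ℂ (e i) f‖ ^ 2 ≤ B * ‖f‖ ^ 2 := fun f =>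
    (hsum f).tsum_le_of_sum_le (hs f)
  -- The analysis operator into ℓ². The upper bound makes it continuous, so the lower bound is a
  -- closed condition.
  let T : H →ₗ[ℂ] lp (fun _ : ι => ℂ) 2 :=
    { toFun := fun f => ⟨fun i => inner ℂ (e i) f, memℓp_gen (by simpa using hsum f)⟩
      map_add' := fun f g => by ext i; exact inner_add_right _ _ _
      map_smul' := fun a f => by ext i; exact inner_smul_right _ _ _ }
  have hT : ∀ f, ‖T f‖ ^ 2 = ∑' i, ‖inner ℂ (e i) f‖ ^ 2 := fun f => by
    have := lp.norm_rpow_eq_tsum (p := 2) (by norm_num) (T f)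
    have h2 : ‖T f‖ ^ 2 = ∑' i, ‖(T f) i‖ ^ 2 := by simpa using this
    exact h2
  have hTc : Continuous T := by
    refine (T.mkContinuous (Real.sqrt B) fun f => ?_).continuous
    refine le_of_sq_le_sq ?_ (by positivity)
    rw [hT, mul_pow, Real.sq_sqrt (hA.le.trans hAB)]
    exact hle f
  refine ⟨hA, hAB, fun f => ⟨hsum f, ?_, hle f⟩⟩
  have hc : IsClosed {f : H | A * ‖f‖ ^ 2 ≤ ‖T f‖ ^ 2} :=
    isClosed_le (by fun_prop) (by fun_prop)
  rw [← hT]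
  exact hc.closure_subset_iff.2 (fun f hf => by
    change A * ‖f‖ ^ 2 ≤ ‖T f‖ ^ 2
    rw [hT]
    exact (h f hf).2.1) (hd f)

namespace Coordinates

/-! ### Estimates for `Δ_k` and `Λ_k` -/

section Correlation

variable {K : Type*} [Field K] [ValuativeRel K] [TopologicalSpace K]
  [IsNonarchimedeanLocalField K] [MeasurableSpace K] [BorelSpace K]
  {p c : ℕ} [Fact p.Prime] [CharP K p] (S : Coordinates K p c)
  (μ : Measure K) [μ.IsAddHaarMeasure] (g : K → ℂ) (a b : K)

lemma del_zero (ξ : K) : Del S μ g a b 0 ξ = ∑' m, ‖fourier S μ g (ξ - b * S.u m)‖ₑ ^ 2 := by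
  simp [Del, u_zero, sq, enorm_mul]

lemma del_le (k : ℕ) (ξ : K) :
    Del S μ g a b k ξ ≤ Del S μ g a b 0 ξ + Del S μ g a b 0 (ξ + a⁻¹ * S.u k) := by
  rw [del_zero, del_zero, ← ENNReal.tsum_add]
  refine ENNReal.tsum_le_tsum fun m => ?_
  rw [enorm_mul, show ξ + a⁻¹ * S.u k - b * S.u m = ξ - b * S.u m + a⁻¹ * S.u k by ring]
  exact enorm_mul_enorm_le _ _

variable {μ} in
lemma ae_add_right {P : K → Prop} (h : ∀ᵐ x ∂μ, P x) (t : K) : ∀ᵐ x ∂μ, P (x + t) :=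
  (measurePreserving_add_right μ t).quasiMeasurePreserving.ae h

lemma ae_del_le (k : ℕ) :
    ∀ᵐ ξ ∂μ, Del S μ g a b k ξ ≤ alpha0 S μ g a b + alpha0 S μ g a b := by
  have h : ∀ᵐ ξ ∂μ, Del S μ g a b 0 ξ ≤ alpha0 S μ g a b := ENNReal.ae_le_essSup _
  filter_upwards [h, ae_add_right h (a⁻¹ * S.u k)] with ξ h1 h2
  exact (S.del_le μ g a b k ξ).trans (add_le_add h1 h2)

variable {μ g}

lemma aestronglyMeasurable_shift {G : K → ℂ} (hG : AEStronglyMeasurable G μ) (s t : K) :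
    AEStronglyMeasurable (fun ξ => G (ξ - s + t)) μ :=
  hG.comp_measurePreserving
    ((measurePreserving_add_right μ t).comp (measurePreserving_sub_right μ s))

lemma aestronglyMeasurable_lam_term (hG : AEStronglyMeasurable (fourier S μ g) μ) (k m : ℕ) :
    AEStronglyMeasurable (fun ξ => fourier S μ g (ξ - b * S.u m) *
      conj (fourier S μ g (ξ - b * S.u m + a⁻¹ * S.u k))) μ := by
  have h1 := aestronglyMeasurable_shift hG (b * S.u m) 0
  simp only [add_zero] at h1
  exact h1.mul (Complex.continuous_conj.comp_aestronglyMeasurable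
    (aestronglyMeasurable_shift hG _ _))

lemma aemeasurable_del (hG : AEStronglyMeasurable (fourier S μ g) μ) (k : ℕ) :
    AEMeasurable (Del S μ g a b k) μ := by
  refine AEMeasurable.tsum fun m => ?_
  have := (S.aestronglyMeasurable_lam_term a b hG k m).enorm
  simpa only [enorm_mul, RCLike.enorm_conj] using this

lemma aestronglyMeasurable_lam (hα : alpha0 S μ g a b < ∞)
    (hG : AEStronglyMeasurable (fourier S μ g) μ) (k : ℕ) :
    AEStronglyMeasurable (Lam S μ g a b k) μ := by
  refine aestronglyMeasurable_of_tendsto_ae atTop (f := fun (n : ℕ) ξ =>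
    ∑ m ∈ Finset.range n, fourier S μ g (ξ - b * S.u m) *
      conj (fourier S μ g (ξ - b * S.u m + a⁻¹ * S.u k))) (fun n => ?_) ?_
  · exact Finset.aestronglyMeasurable_fun_sum _
      fun m _ => S.aestronglyMeasurable_lam_term a b hG k m
  · filter_upwards [S.ae_del_le μ g a b k] with ξ hξ
    have hfin : Del S μ g a b k ξ ≠ ∞ := (hξ.trans_lt (ENNReal.add_lt_top.2 ⟨hα, hα⟩)).ne
    refine (Summable.hasSum (Summable.of_enorm ?_)).tendsto_sum_nat
    simpa only [Del, enorm_mul, RCLike.enorm_conj] using hfin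

lemma memLp_shift {F : K → ℂ} (hF : MemLp F 2 μ) (t : K) : MemLp (fun x => F (x + t)) 2 μ :=
  hF.comp_measurePreserving (measurePreserving_add_right μ t)

/-- Sum and integral may be exchanged because `Δ_k ≤ 2 α₀` almost everywhere, while `F` times its
conjugated translate is integrable. -/
lemma hasSum_integral_autocorrelation (hα : alpha0 S μ g a b < ∞)
    (hG : AEStronglyMeasurable (fourier S μ g) μ) {F : K → ℂ} (hF : MemLp F 2 μ) (k : ℕ) :
    HasSum (fun m => ∫ x, (F x * conj (fourier S μ g (x - b * S.u m))) *
        conj (F (x + a⁻¹ * S.u k) * conj (fourier S μ g (x + a⁻¹ * S.u k - b * S.u m))) ∂μ)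
      (∫ x, F x * conj (F (x + a⁻¹ * S.u k)) * conj (Lam S μ g a b k x) ∂μ) := by
  let E : K → ℂ := fun x => F x * conj (F (x + a⁻¹ * S.u k))
  have hE : Integrable E μ := hF.integrable_mul (memLp_shift hF _).star
  let Φ : ℕ → K → ℂ := fun m x => E x * conj (fourier S μ g (x - b * S.u m) *
      conj (fourier S μ g (x - b * S.u m + a⁻¹ * S.u k)))
  have hΦm : ∀ m, AEStronglyMeasurable (Φ m) μ := fun m => hE.1.mul
    (Complex.continuous_conj.comp_aestronglyMeasurable
      (S.aestronglyMeasurable_lam_term a b hG k m))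
  have hfin : ∑' m, ∫⁻ x, ‖Φ m x‖ₑ ∂μ ≠ ∞ := by
    rw [← lintegral_tsum fun m => (hΦm m).enorm]
    have h1 : ∀ x, ∑' m, ‖Φ m x‖ₑ = ‖E x‖ₑ * Del S μ g a b k x := fun x => by
      simp only [Φ, Del, enorm_mul, RCLike.enorm_conj, ENNReal.tsum_mul_left]
    simp_rw [h1]
    refine ne_top_of_le_ne_top (b := ∫⁻ x, ‖E x‖ₑ * (alpha0 S μ g a b + alpha0 S μ g a b) ∂μ) ?_
      (lintegral_mono_ae ?_)
    · rw [lintegral_mul_const' _ _ (ENNReal.add_lt_top.2 ⟨hα, hα⟩).ne]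
      exact ENNReal.mul_ne_top hE.2.ne (ENNReal.add_lt_top.2 ⟨hα, hα⟩).ne
    · filter_upwards [S.ae_del_le μ g a b k] with x hx
      gcongr
  have hΦ : ∀ m, Integrable (Φ m) μ := fun m =>
    ⟨hΦm m, (ENNReal.le_tsum m).trans_lt hfin.lt_top⟩
  have hsum : Summable fun m => ∫ x, ‖Φ m x‖ ∂μ := by
    simp_rw [fun m => integral_norm_eq_lintegral_enorm (hΦm m)]
    exact ENNReal.summable_toReal hfin
  have key := hasSum_integral_of_summable_integral_norm hΦ hsum
  have h2 : ∀ x, ∑' m, Φ m x = E x * conj (Lam S μ g a b k x) := fun x => by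
    rw [Lam, Complex.conj_tsum, ← tsum_mul_left]
  simp_rw [h2] at key
  have h3 : (fun m => ∫ x, (F x * conj (fourier S μ g (x - b * S.u m))) *
        conj (F (x + a⁻¹ * S.u k) * conj (fourier S μ g (x + a⁻¹ * S.u k - b * S.u m))) ∂μ) =
      fun m => ∫ x, Φ m x ∂μ := by
    ext m
    congr 1
    ext x
    simp only [Φ, E, map_mul, Complex.conj_conj]
    rw [show x + a⁻¹ * S.u k - b * S.u m = x - b * S.u m + a⁻¹ * S.u k by ring]
    ring
  rw [h3]
  exact key

/-- Valid also where `Δ₀` is infinite: the divergent sum and `toReal` both default to 0. -/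
lemma lam_zero (x : K) : Lam S μ g a b 0 x = ((Del S μ g a b 0 x).toReal : ℂ) := by
  rw [del_zero, ENNReal.tsum_toReal_eq (fun m => ENNReal.pow_ne_top enorm_ne_top), Complex.ofReal_tsum,
    Lam]
  congr 1
  ext m
  rw [u_zero, mul_zero, add_zero, Complex.mul_conj']
  simp

/-- The diagonal term of the Gabor frame operator. -/
lemma integral_lam_zero (hα : alpha0 S μ g a b < ∞)
    (hG : AEStronglyMeasurable (fourier S μ g) μ) {F : K → ℂ} (hF : MemLp F 2 μ) :
    ∫ x, F x * conj (F (x + a⁻¹ * S.u 0)) * conj (Lam S μ g a b 0 x) ∂μ =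
      ((∫⁻ x, ‖F x‖ₑ ^ 2 * Del S μ g a b 0 x ∂μ).toReal : ℂ) := by
  have h1 : ∀ x, F x * conj (F (x + a⁻¹ * S.u 0)) * conj (Lam S μ g a b 0 x) =
      ((‖F x‖ ^ 2 * (Del S μ g a b 0 x).toReal : ℝ) : ℂ) := fun x => by
    rw [lam_zero, u_zero, mul_zero, add_zero, Complex.mul_conj', Complex.conj_ofReal]
    push_cast; rfl
  have hm : AEStronglyMeasurable (fun x => ‖F x‖ ^ 2 * (Del S μ g a b 0 x).toReal) μ :=
    (hF.1.norm.pow 2).mul (S.aemeasurable_del a b hG 0).ennreal_toReal.aestronglyMeasurable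
  simp_rw [h1]
  rw [integral_complex_ofReal, integral_eq_lintegral_of_nonneg_ae
    (Eventually.of_forall fun x => by positivity) hm]
  congr 2
  refine lintegral_congr_ae ?_
  have h : ∀ᵐ ξ ∂μ, Del S μ g a b 0 ξ ≤ alpha0 S μ g a b := ENNReal.ae_le_essSup _
  filter_upwards [h] with x hx
  rw [ENNReal.ofReal_mul (sq_nonneg _), ENNReal.ofReal_toReal (hx.trans_lt hα).ne,
    enorm_sq_eq_ofReal]

lemma lintegral_mul_del_le (hα : alpha0 S μ g a b < ∞) (F : K → ℂ) :
    ∫⁻ x, ‖F x‖ₑ ^ 2 * Del S μ g a b 0 x ∂μ ≤ (∫⁻ x, ‖F x‖ₑ ^ 2 ∂μ) * alpha0 S μ g a b := by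
  rw [← lintegral_mul_const' _ _ hα.ne]
  have h : ∀ᵐ ξ ∂μ, Del S μ g a b 0 ξ ≤ alpha0 S μ g a b := ENNReal.ae_le_essSup _
  refine lintegral_mono_ae ?_
  filter_upwards [h] with x hx
  gcongr

lemma le_lintegral_mul_del (hγ : gam S μ g a b ≠ ∞) (F : K → ℂ) :
    (∫⁻ x, ‖F x‖ₑ ^ 2 ∂μ) * gam S μ g a b ≤ ∫⁻ x, ‖F x‖ₑ ^ 2 * Del S μ g a b 0 x ∂μ := by
  rw [← lintegral_mul_const' _ _ hγ]
  have h : ∀ᵐ ξ ∂μ, gam S μ g a b ≤ Del S μ g a b 0 ξ := ae_essInf_le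
  refine lintegral_mono_ae ?_
  filter_upwards [h] with x hx
  gcongr

/-- Shifting the argument swaps the two factors of each term up to conjugation, which negates the
lattice vector. -/
lemma enorm_lam_sub (k : ℕ) (x : K) :
    ‖Lam S μ g a b k (x - a⁻¹ * S.u k)‖ₑ = ‖Lam S μ g a b (S.negEquiv k) x‖ₑ := by
  rw [← RCLike.enorm_conj, Lam, Complex.conj_tsum, Lam]
  congr 2
  ext m
  rw [u_negEquiv, map_mul, Complex.conj_conj, mul_comm]
  ring_nf

lemma sum_enorm_lam_le (L : Finset ℕ) (x : K) :
    ∑ l ∈ L.erase 0, ‖Lam S μ g a b l x‖ₑ ≤ ∑' k : ℕ, ‖Lam S μ g a b (k + 1) x‖ₑ := by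
  let w : ℕ → ℝ≥0∞ := fun l => if l = 0 then 0 else ‖Lam S μ g a b l x‖ₑ
  calc ∑ l ∈ L.erase 0, ‖Lam S μ g a b l x‖ₑ = ∑ l ∈ L.erase 0, w l :=
        Finset.sum_congr rfl fun l hl => by simp [w, Finset.ne_of_mem_erase hl]
    _ ≤ ∑' l, w l := ENNReal.sum_le_tsum _
    _ = ∑' k : ℕ, ‖Lam S μ g a b (k + 1) x‖ₑ := by
        rw [tsum_eq_zero_add' ENNReal.summable]; simp [w]

lemma sum_enorm_lam_neg_le (L : Finset ℕ) (x : K) :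
    ∑ l ∈ L.erase 0, ‖Lam S μ g a b (S.negEquiv l) x‖ₑ ≤
      ∑' k : ℕ, ‖Lam S μ g a b (k + 1) x‖ₑ := by
  refine le_trans (le_of_eq ?_) (S.sum_enorm_lam_le a b (L.map S.negEquiv.toEmbedding) x)
  have : (L.map S.negEquiv.toEmbedding).erase 0 = (L.erase 0).map S.negEquiv.toEmbedding := by
    have h0 : S.negEquiv.toEmbedding 0 = 0 := S.negEquiv_eq_zero_iff.2 rfl
    rw [Finset.map_erase, h0]
  rw [this, Finset.sum_map]
  rfl

/-- The off-diagonal terms of the Gabor frame operator. -/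
lemma sum_enorm_integral_lam_le (hα : alpha0 S μ g a b < ∞) (hσ : sig S μ g a b ≠ ∞)
    (hG : AEStronglyMeasurable (fourier S μ g) μ) {F : K → ℂ} (hF : MemLp F 2 μ) (L : Finset ℕ) :
    ∑ l ∈ L.erase 0, ‖∫ x, F x * conj (F (x + a⁻¹ * S.u l)) * conj (Lam S μ g a b l x) ∂μ‖ₑ ≤
      (∫⁻ x, ‖F x‖ₑ ^ 2 ∂μ) * sig S μ g a b := by
  have hσ' : ∀ᵐ x ∂μ, ∑' k : ℕ, ‖Lam S μ g a b (k + 1) x‖ₑ ≤ sig S μ g a b :=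
    ENNReal.ae_le_essSup _
  have hm : ∀ l, AEMeasurable (fun x => ‖F x‖ₑ ^ 2 * ‖Lam S μ g a b l x‖ₑ) μ := fun l =>
    (hF.1.enorm.pow_const 2).mul (S.aestronglyMeasurable_lam a b hα hG l).enorm
  have bound : ∀ w : ℕ → ℕ, (∀ x, ∑ l ∈ L.erase 0, ‖Lam S μ g a b (w l) x‖ₑ ≤
      ∑' k : ℕ, ‖Lam S μ g a b (k + 1) x‖ₑ) →
      ∑ l ∈ L.erase 0, ∫⁻ x, ‖F x‖ₑ ^ 2 * ‖Lam S μ g a b (w l) x‖ₑ ∂μ ≤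
        (∫⁻ x, ‖F x‖ₑ ^ 2 ∂μ) * sig S μ g a b := by
    intro w hw
    rw [← lintegral_finsetSum' _ fun l _ => hm (w l), ← lintegral_mul_const' _ _ hσ]
    refine lintegral_mono_ae ?_
    filter_upwards [hσ'] with x hx
    rw [← Finset.mul_sum]
    exact mul_le_mul_right ((hw x).trans hx) _
  -- The arithmetic–geometric inequality gives two halves; translating the second turns index `l`
  -- into `negEquiv l`, which again runs over nonzero indices.
  have hterm : ∀ l, 2 * ‖∫ x, F x * conj (F (x + a⁻¹ * S.u l)) * conj (Lam S μ g a b l x) ∂μ‖ₑ ≤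
      ∫⁻ x, ‖F x‖ₑ ^ 2 * ‖Lam S μ g a b l x‖ₑ ∂μ +
        ∫⁻ x, ‖F x‖ₑ ^ 2 * ‖Lam S μ g a b (S.negEquiv l) x‖ₑ ∂μ := by
    intro l
    have h1 : ∫⁻ x, ‖F x‖ₑ ^ 2 * ‖Lam S μ g a b (S.negEquiv l) x‖ₑ ∂μ =
        ∫⁻ x, ‖F (x + a⁻¹ * S.u l)‖ₑ ^ 2 * ‖Lam S μ g a b l x‖ₑ ∂μ := by
      rw [← lintegral_add_right_eq_self _ (a⁻¹ * S.u l)]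
      simp_rw [← enorm_lam_sub, add_sub_cancel_right]
    rw [h1, ← lintegral_add_left' (hm l)]
    calc 2 * ‖∫ x, F x * conj (F (x + a⁻¹ * S.u l)) * conj (Lam S μ g a b l x) ∂μ‖ₑ
        ≤ 2 * ∫⁻ x, ‖F x * conj (F (x + a⁻¹ * S.u l)) * conj (Lam S μ g a b l x)‖ₑ ∂μ := by
          gcongr; exact enorm_integral_le_lintegral_enorm _
      _ = ∫⁻ x, 2 * ‖F x * conj (F (x + a⁻¹ * S.u l)) * conj (Lam S μ g a b l x)‖ₑ ∂μ :=
          (lintegral_const_mul' _ _ ENNReal.ofNat_ne_top).symm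
      _ ≤ _ := by
          refine lintegral_mono fun x => ?_
          simp only [enorm_mul, RCLike.enorm_conj]
          rw [← mul_assoc, ← add_mul]
          exact mul_le_mul_left (two_mul_enorm_mul_enorm_le _ _) _
  have h2 : 2 * ∑ l ∈ L.erase 0,
      ‖∫ x, F x * conj (F (x + a⁻¹ * S.u l)) * conj (Lam S μ g a b l x) ∂μ‖ₑ ≤
      2 * ((∫⁻ x, ‖F x‖ₑ ^ 2 ∂μ) * sig S μ g a b) := by
    rw [Finset.mul_sum, two_mul ((∫⁻ x, ‖F x‖ₑ ^ 2 ∂μ) * sig S μ g a b)]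
    refine (Finset.sum_le_sum fun l _ => hterm l).trans ?_
    rw [Finset.sum_add_distrib]
    exact add_le_add (bound id (S.sum_enorm_lam_le a b L))
      (bound _ (S.sum_enorm_lam_neg_le a b L))
  exact (ENNReal.mul_le_mul_iff_right two_ne_zero ENNReal.ofNat_ne_top).1 h2

end Correlation

/-! ### Gabor coefficients and the frame bounds on test functions -/

section Frame

variable {K : Type*} [Field K] [ValuativeRel K] [TopologicalSpace K]
  [IsNonarchimedeanLocalField K] [MeasurableSpace K] [BorelSpace K]
  {p c : ℕ} [Fact p.Prime] [CharP K p] (S : Coordinates K p c)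
  {μ : Measure K} [μ.IsAddHaarMeasure]

lemma isFourier_gaborFun (hμ : μ {x : K | valuation K x ≤ 1} = 1) (g : Lp ℂ 2 μ) (a b : K)
    (m n : ℕ) : S.IsFourier μ (gaborFun S g a b m n) (fun ξ =>
      conj (S.χ ((ξ - b * S.u m) * (S.u n * a)) : ℂ) * fourier S μ g (ξ - b * S.u m)) := by
  have h1 := (S.isFourier_fourier hμ (Lp.memLp g)).translation (S.u n * a)
  have h2 := h1.modulation (b * S.u m) hμ
    ((Lp.memLp g).comp_measurePreserving (measurePreserving_sub_right μ (S.u n * a)))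
  have h3 : gaborFun S g a b m n =
      fun x => (S.χ (b * S.u m * x) : ℂ) * (g : K → ℂ) (x - S.u n * a) := by
    ext x
    rw [gaborFun, show S.u m * (b * x) = b * S.u m * x by ring]
  rw [h3]
  exact h2

lemma norm_inner_gabor (hμ : μ {x : K | valuation K x ≤ 1} = 1) (g : Lp ℂ 2 μ) (a b : K)
    {f : Lp ℂ 2 μ} {F : K → ℂ} (hF : S.fourierIsometry hμ f =ᵐ[μ] F) (m n : ℕ) :
    ‖inner ℂ (gabor S μ g a b (m, n)) f‖ =
      ‖∫ x, F x * conj (fourier S μ g (x - b * S.u m)) * (S.χ (S.u n * (a * x)) : ℂ) ∂μ‖ := by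
  have h1 := S.coeFn_fourierIsometry_of_isFourier hμ
    ((S.isFourier_gaborFun hμ g a b m n).congr_left
      (memLp_gaborFun S μ g a b m n).coeFn_toLp.symm)
  rw [← (S.fourierIsometry hμ).inner_map_map, L2.inner_def]
  have h2 : ∫ x, inner ℂ (S.fourierIsometry hμ (gabor S μ g a b (m, n)) x)
      (S.fourierIsometry hμ f x) ∂μ =
      (S.χ (-(b * S.u m) * (S.u n * a)) : ℂ) * ∫ x, F x *
        conj (fourier S μ g (x - b * S.u m)) * (S.χ (S.u n * (a * x)) : ℂ) ∂μ := by
    rw [← integral_const_mul]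
    refine integral_congr_ae ?_
    filter_upwards [h1, hF] with x hx hFx
    rw [hFx]
    change inner ℂ (S.fourierIsometry hμ ((memLp_gaborFun S μ g a b m n).toLp _) x) _ = _
    rw [hx, RCLike.inner_apply, map_mul, Complex.conj_conj,
      show (x - b * S.u m) * (S.u n * a) = -(b * S.u m) * (S.u n * a) + S.u n * (a * x) by ring,
      χ_add]
    ring
  rw [h2, norm_mul, Circle.norm_coe, one_mul]

lemma exists_hasSum_gabor (hμ : μ {x : K | valuation K x ≤ 1} = 1) {a : K} (ha : a ≠ 0) (b : K)
    {g : K → ℂ} (hα : alpha0 S μ g a b < ∞) (hG : MemLp (fourier S μ g) 2 μ) {F : K → ℂ}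
    (hF : MemLp F 2 μ) {M : ℕ} (hM : ∀ x, x ∉ ball (S.π ^ M) → F x = 0) {C : ℝ}
    (hC : ∀ x, ‖F x‖ ≤ C) {L : Finset ℕ} (hL : ∀ k, a⁻¹ * S.u k ∈ ball (S.π ^ M) → k ∈ L) :
    ∃ R : ℝ, HasSum (fun i : ℕ × ℕ => ‖∫ x, F x * conj (fourier S μ g (x - b * S.u i.1)) *
        (S.χ (S.u i.2 * (a * x)) : ℂ) ∂μ‖ ^ 2) R ∧
      (R : ℂ) = ((modulus a)⁻¹ : ℝ) *
        ∑ l ∈ L, ∫ x, F x * conj (F (x + a⁻¹ * S.u l)) * conj (Lam S μ g a b l x) ∂μ := by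
  -- Boundedness of `F` is what keeps these products in L².
  have hh : ∀ m, MemLp (fun x => F x * conj (fourier S μ g (x - b * S.u m))) 2 μ := fun m =>
    (((hG.comp_measurePreserving (measurePreserving_sub_right μ (b * S.u m))).star).mul
      (MemLp.of_le_mul (p := ∞) (c := C) (memLp_top_const (1 : ℂ)) hF.1
        (Eventually.of_forall fun x => by simpa using hC x)))
  choose R hR hR' using fun m => S.exists_hasSum_sq_norm_integral hμ ha (hh m) (M := M)
    (fun x hx => by rw [hM x hx, zero_mul]) hL
  have h1 : HasSum (fun m => (R m : ℂ)) (((modulus a)⁻¹ : ℝ) *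
      ∑ l ∈ L, ∫ x, F x * conj (F (x + a⁻¹ * S.u l)) * conj (Lam S μ g a b l x) ∂μ) := by
    simp_rw [hR']
    exact (hasSum_sum fun l _ => S.hasSum_integral_autocorrelation a b hα hG.1 hF l).mul_left _
  have h2 := Complex.hasSum_ofReal.1
    (show HasSum (fun m => (R m : ℂ)) ((∑' m, R m : ℝ) : ℂ) by
      rw [Complex.ofReal_tsum]; exact h1.summable.hasSum)
  refine ⟨∑' m, R m, ?_, ?_⟩
  · have hs : Summable fun i : ℕ × ℕ => ‖∫ x, F x * conj (fourier S μ g (x - b * S.u i.1)) *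
        (S.χ (S.u i.2 * (a * x)) : ℂ) ∂μ‖ ^ 2 := by
      rw [summable_prod_of_nonneg fun _ => sq_nonneg _]
      refine ⟨fun m => (hR m).summable, ?_⟩
      simp_rw [fun m => (hR m).tsum_eq]
      exact h2.summable
    have h3 := hs.hasSum.prod_fiberwise hR
    rw [h2.unique h3]
    exact hs.hasSum
  · rw [Complex.ofReal_tsum, h1.tsum_eq]

lemma gabor_bounds (hμ : μ {x : K | valuation K x ≤ 1} = 1) {a : K} (ha : a ≠ 0) (b : K)
    (g : Lp ℂ 2 μ) (hγ : gam S μ g a b ≠ ∞) (hα : alpha0 S μ g a b < ∞) (hσ : sig S μ g a b ≠ ∞)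
    {f : Lp ℂ 2 μ} (hf : f ∈ S.testSubmodule hμ) :
    Summable (fun i => ‖inner ℂ (gabor S μ g a b i) f‖ ^ 2) ∧
      ((gam S μ g a b).toReal - (sig S μ g a b).toReal) / modulus a * ‖f‖ ^ 2 ≤
        ∑' i, ‖inner ℂ (gabor S μ g a b i) f‖ ^ 2 ∧
      ∑' i, ‖inner ℂ (gabor S μ g a b i) f‖ ^ 2 ≤
        ((alpha0 S μ g a b).toReal + (sig S μ g a b).toReal) / modulus a * ‖f‖ ^ 2 := by
  classical
  have hmod := modulus_pos K ha
  have hG := (S.isFourier_fourier hμ (Lp.memLp g)).1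
  obtain ⟨M, C, hMC⟩ := hf
  -- A representative satisfying the bound and the support condition everywhere, not just almost
  -- everywhere.
  let F : K → ℂ := fun x => if ‖S.fourierIsometry hμ f x‖ ≤ C ∧
    (x ∉ ball (S.π ^ M) → S.fourierIsometry hμ f x = 0) then S.fourierIsometry hμ f x else 0
  have hFae : S.fourierIsometry hμ f =ᵐ[μ] F := by
    filter_upwards [hMC] with x hx
    exact (if_pos hx).symm
  have hF : MemLp F 2 μ := (Lp.memLp (S.fourierIsometry hμ f)).ae_eq hFae
  have hM : ∀ x, x ∉ ball (S.π ^ M) → F x = 0 := fun x hx => by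
    by_cases h : ‖S.fourierIsometry hμ f x‖ ≤ C ∧
      (x ∉ ball (S.π ^ M) → S.fourierIsometry hμ f x = 0)
    · exact (if_pos h).trans (h.2 hx)
    · exact if_neg h
  have hC : ∀ x, ‖F x‖ ≤ max C 0 := fun x => by
    by_cases h : ‖S.fourierIsometry hμ f x‖ ≤ C ∧
      (x ∉ ball (S.π ^ M) → S.fourierIsometry hμ f x = 0)
    · simp only [F, if_pos h]; exact h.1.trans (le_max_left _ _)
    · simp only [F, if_neg h, norm_zero]; exact le_max_right _ _
  let L : Finset ℕ := (S.finite_u_mem_ball M ha).toFinset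
  have hL : ∀ k, a⁻¹ * S.u k ∈ ball (S.π ^ M) → k ∈ L := fun k hk =>
    (Set.Finite.mem_toFinset _).2 hk
  obtain ⟨R, hR, hR'⟩ := S.exists_hasSum_gabor hμ ha b hα hG hF hM hC hL
  have hcoef : (fun i => ‖inner ℂ (gabor S μ g a b i) f‖ ^ 2) = fun i : ℕ × ℕ =>
      ‖∫ x, F x * conj (fourier S μ g (x - b * S.u i.1)) *
        (S.χ (S.u i.2 * (a * x)) : ℂ) ∂μ‖ ^ 2 :=
    funext fun i => by rw [← S.norm_inner_gabor hμ g a b hFae]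
  rw [hcoef, hR.tsum_eq]
  refine ⟨hR.summable, ?_⟩
  -- the energy of `f`
  have hE : ∫⁻ x, ‖F x‖ₑ ^ 2 ∂μ = ENNReal.ofReal (‖f‖ ^ 2) := by
    rw [← eLpNorm_two_sq, ← eLpNorm_congr_ae hFae, ENNReal.ofReal_pow (norm_nonneg _),
      ← (S.fourierIsometry hμ).norm_map, Lp.norm_def, ENNReal.ofReal_toReal (Lp.eLpNorm_ne_top _)]
  have hE' : (∫⁻ x, ‖F x‖ₑ ^ 2 ∂μ).toReal = ‖f‖ ^ 2 := by
    rw [hE, ENNReal.toReal_ofReal (sq_nonneg _)]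
  have hEtop : ∫⁻ x, ‖F x‖ₑ ^ 2 ∂μ ≠ ∞ := hE ▸ ENNReal.ofReal_ne_top
  -- the diagonal part
  set T := (∫⁻ x, ‖F x‖ₑ ^ 2 * Del S μ g a b 0 x ∂μ).toReal with hT
  have hTle := S.lintegral_mul_del_le (μ := μ) a b hα F
  have hTtop := ENNReal.mul_ne_top hEtop hα.ne
  have hT1 : T ≤ ‖f‖ ^ 2 * (alpha0 S μ g a b).toReal := by
    rw [← hE', ← ENNReal.toReal_mul]; exact ENNReal.toReal_mono hTtop hTle
  have hT2 : ‖f‖ ^ 2 * (gam S μ g a b).toReal ≤ T := by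
    rw [← hE', ← ENNReal.toReal_mul]
    exact ENNReal.toReal_mono (ne_top_of_le_ne_top hTtop hTle) (S.le_lintegral_mul_del a b hγ F)
  -- the off-diagonal part
  let U : ℂ := ∑ l ∈ L.erase 0,
    ∫ x, F x * conj (F (x + a⁻¹ * S.u l)) * conj (Lam S μ g a b l x) ∂μ
  have hU : ‖U‖ ≤ ‖f‖ ^ 2 * (sig S μ g a b).toReal := by
    rw [← hE', ← ENNReal.toReal_mul, ← toReal_enorm]
    refine ENNReal.toReal_mono (ENNReal.mul_ne_top hEtop hσ) ?_
    exact (enorm_sum_le _ _).trans (S.sum_enorm_integral_lam_le a b hα hσ hG.1 hF L)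
  have hsplit : R = (modulus a)⁻¹ * (T + U.re) := by
    have h0 : (0 : ℕ) ∈ L := hL 0 (by rw [u_zero, mul_zero]; exact zero_mem_ball _)
    rw [← Finset.add_sum_erase _ _ h0, S.integral_lam_zero a b hα hG.1 hF] at hR'
    have := congrArg Complex.re hR'
    rwa [Complex.re_ofReal_mul, Complex.add_re, Complex.ofReal_re, Complex.ofReal_re] at this
  have hre := abs_le.1 ((Complex.abs_re_le_norm U).trans hU)
  rw [hsplit, div_mul_eq_mul_div, div_mul_eq_mul_div, inv_mul_eq_div]
  constructor
  · refine (div_le_div_iff_of_pos_right hmod).2 ?_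
    linarith [hre.1]
  · refine (div_le_div_iff_of_pos_right hmod).2 ?_
    linarith [hre.2]

end Frame

end Coordinates

end LocalFieldGabor

end

/-! ### Passage from test functions to all of L² -/

theorem theorem2p3 {K : Type*} [Field K] [ValuativeRel K] [TopologicalSpace K]
    [IsNonarchimedeanLocalField K] [MeasurableSpace K] [BorelSpace K]
    (p c : ℕ) [Fact p.Prime] [CharP K p] (S : LocalFieldGabor.Coordinates K p c)
    (μ : MeasureTheory.Measure K) [μ.IsAddHaarMeasure] (hμ : μ {x : K | valuation K x ≤ 1} = 1)
    (a b : K) (ha : a ≠ 0) (hb : b ≠ 0) (g : MeasureTheory.Lp ℂ 2 μ)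
    (hσγ : LocalFieldGabor.sig S μ g a b < LocalFieldGabor.gam S μ g a b)
    (hγα : LocalFieldGabor.gam S μ g a b ≤ LocalFieldGabor.alpha0 S μ g a b)
    (hα : LocalFieldGabor.alpha0 S μ g a b < ∞) :
    LocalFieldGabor.IsFrameWithBounds (LocalFieldGabor.gabor S μ g a b)
      (((LocalFieldGabor.gam S μ g a b).toReal - (LocalFieldGabor.sig S μ g a b).toReal) /
        LocalFieldGabor.modulus a)
      (((LocalFieldGabor.alpha0 S μ g a b).toReal + (LocalFieldGabor.sig S μ g a b).toReal) /
        LocalFieldGabor.modulus a) := by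
  have hmod := LocalFieldGabor.modulus_pos K ha
  have hγ := (hγα.trans_lt hα).ne
  have h1 := ENNReal.toReal_strict_mono hγ hσγ
  have h2 := ENNReal.toReal_mono hα.ne hγα
  refine LocalFieldGabor.isFrameWithBounds_of_dense (div_pos (sub_pos.2 h1) hmod) ?_
    (S.dense_testSubmodule hμ) fun f hf => S.gabor_bounds hμ ha b g hγ hα hσγ.ne_top hf
  refine (div_le_div_iff_of_pos_right hmod).2 ?_
  linarith [ENNReal.toReal_nonneg (a := LocalFieldGabor.sig S μ g a b)]
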